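/- **Setting.** Let $G$ be a parent graph on $V=\{1,\dots,d\}$: a directed acyclic graph in which every arrow $i\leftarrow k$ satisfies $i<k$ (connectedness is not needed). Let $C,M\subseteq V$ be disjoint (conditioning and marginalising set). Let $F$ be the set of ancestors of $C$ outside $C$, $R=C\cup F$, $O=V\setminus R$, and $u=O\setminus M$, $p=O\cap M$, $v=F\setminus M$, $q=F\cap M$, so that $V\setminus(C\cup M)=u\cup v$. *Summary graph.* For a binary matrix $\mathcal F$, $\operatorname{zer}_a\mathcal F$ is $\mathcal F$ with additional ones at all $(i,k)$ joined by a path $i,s,\dots,t,k$ of $\mathcal F$ with inner nodes $s,\dots,t$ in $a$. Let $\mathcal A$ be the edge matrix of $G$ with unit diagonal, $\mathcal D=\operatorname{zer}_p\mathcal A$, and $\mathcal Z=\operatorname{zer}_q\operatorname{In}[\mathcal A_{RR}^{T}\mathcal A_{RR}]_{FF}$, where $\operatorname{In}$ turns non-zero entries into ones. The summary graph on $u\cup v$ has arrows $i\leftarrow k$ ($i\in u$) given by $\mathcal H_{uu}=\mathcal D_{uu}$ and $\mathcal H_{uv}=\operatorname{In}[\mathcal D_{uv}+\mathcal D_{uq}\mathcal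 Z_{qv}]$, dashed lines within $u$ given by $\mathcal W_{uu}=\operatorname{In}[\mathcal I+\mathcal D_{up}\mathcal D_{up}^{T}+\mathcal D_{uq}\mathcal Z_{qq}\mathcal D_{uq}^{T}]$, and full lines within $v$ given by $\mathcal Z_{vv}$. For $i\in u$ let $c_i$ be the set of ancestors of $i$ in $u$ and $m_i=u\setminus c_i$. *Active paths.* A path has distinct nodes and specified edges. An inner node is a collision node if each of the two neighbouring edges of the path is there an arrowhead or the end of a dashed line; otherwise it is a transmitting node. A path is active relative to $[c,m]$ if every inner transmitting node is in $m$ and every inner collision node is in $c$ or has a descendant in $c$ (so a single edge is always active). The path consisting of the arrow $i\leftarrow k$ alone, which is the dependence under study, is disregarded below. *Models.* Let $Y=(Y_1,\dots,Y_d)$ be a mean-centred square-integrable random vector (for example Gaussian) with $AY=\varepsilon$, where $A$ has unit diagonal, $A_{ik}=0$ for $i\ne k$ unless $i\leftarrow k$ in $G$, and the residuals $\varepsilon_i$ are uncorrelated with variances $\Delta_i>0$; the generating dependence of $Y_i$ on $Y_k$ is $-A_{ik}$. The summary graph model given $Y_C$ has equations $H_{uu}Y_u+H_{uv}Y_v=\eta_u$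 with $\operatorname{cov}(\eta_u)=W_{uu}$, where, with $D=\operatorname{inv}_pA$ (partial inversion) and $\operatorname{inv}_q[A_{RR}^T\Delta_{RR}^{-1}A_{RR}]_{FF}$ having blocks $\Sigma_{qq|vC}$ and $\Pi_{q|v.C}$, $$H_{uu}=D_{uu},\quad H_{uv}=D_{uv}+D_{uq}\Pi_{q|v.C},\quad W_{uu}=\Delta_{uu}+D_{up}\Delta_{pp}D_{up}^T+D_{uq}\Sigma_{qq|vC}D_{uq}^T .$$ The dependence of $Y_i$ on $Y_k$ in the MAG (maximal ancestral graph) model on $V\setminus(C\cup M)$ is the coefficient $\beta_{ik}$ of $Y_k$ in the linear least-squares regression of $Y_i$ on $Y_{c_i},Y_v,Y_C$. **Corollary (lack of confounding in measures of conditional dependence).** Let $i\leftarrow k$ be an arrow of $G$ with $i\in u$ and $k\in u\cup v$. 1. If $G$ has no active $ik$-path relative to $[C,M]$ other than the arrow $i\leftarrow k$, then the generating dependence is free of direct confounding: in the summary graph the pair $i,k$ has no double edge, the arrow $i\leftarrow k$ is not also induced by marginalising and conditioning (no $p$-line path in $\mathcal A$ joins $i$ to $k$ and, if $k\in v$, $(\mathcal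 D_{iq}\mathcal Z_{qk})=0$), $H_{ik}=A_{ik}$, and $W_{ik}=0$ if $k\in u$. 2. If the summary graph has no active $ik$-path relative to $[c_i,m_i]$ other than the arrow $i\leftarrow k$, then the dependence is free of indirect confounding: $\mathcal W_{ic}\mathcal W_{cc}^{-}\mathcal H_{ck}=0$ for $c=c_i$, where $\mathcal W_{cc}^-$ is the reflexive transitive closure of $\mathcal W_{cc}$ (conditioning on $Y_{c_i}$ induces no further $ik$-edge), and $\beta_{ik}=-H_{ik}$. 3. If both conditions hold, the generating dependence is undistorted in the MAG model: $\beta_{ik}=-A_{ik}$. -/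

import Mathlib

open MeasureTheory ProbabilityTheory

/-! ## Graphs with arrows, dashed lines and full lines, and their active paths -/

/-- A graph with three kinds of edges: `arrow i k` is `i ← k` (so `k` is a parent of `i`),
`dashed i k` is an edge `i - - k` of a covariance graph, `full i k` is an edge `i — k` of a
concentration graph.  Several kinds of edges may couple the same pair. -/
structure MixedGraph (V : Type) where
  arrow : V → V → Prop
  dashed : V → V → Prop
  full : V → V → Prop

/-- The four ways in which an edge can be traversed from its first to its second node. -/
inductive EdgeKind where
  | left
  | right
  | dashed
  | full

namespace EdgeKind

/-- The edge has an arrowhead, or the end of a dashed line, at its first node. -/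
def meetsFirst : EdgeKind → Prop
  | left => True
  | right => False
  | dashed => True
  | full => False

/-- The edge has an arrowhead, or the end of a dashed line, at its second node. -/
def meetsSecond : EdgeKind → Prop
  | left => False
  | right => True
  | dashed => True
  | full => False

end EdgeKind

namespace MixedGraph

variable {V : Type}

/-- The nodes `a`, `b` are coupled by an edge of the given kind: `a ← b`, `a → b`, `a - - b`
or `a — b`. -/
def HasEdge (G : MixedGraph V) (a : V) : EdgeKind → V → Prop
  | .left, b => G.arrow a b
  | .right, b => G.arrow b a
  | .dashed, b => G.dashed a b
  | .full, b => G.full a b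

/-- `k` is an ancestor of `i` (and `i` a descendant of `k`): there is a path of arrows
`i ← ⋯ ← k`. -/
def Ancestor (G : MixedGraph V) (i k : V) : Prop :=
  Relation.TransGen G.arrow i k

/-- The nodes `x 0, …, x n` are distinct, `n` is positive, and `e j` is an edge that couples
`x j` with `x (j + 1)`. -/
def IsPath (G : MixedGraph V) (n : ℕ) (x : ℕ → V) (e : ℕ → EdgeKind) : Prop :=
  0 < n ∧ (∀ j < n, G.HasEdge (x j) (e j) (x (j + 1))) ∧ Set.InjOn x (Set.Iic n)

/-- The inner node `x (j + 1)` is a collision node: both neighbouring edges of the path have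
an arrowhead or the end of a dashed line there.  Otherwise it is a transmitting node. -/
def IsCollision (e : ℕ → EdgeKind) (j : ℕ) : Prop :=
  (e j).meetsSecond ∧ (e (j + 1)).meetsFirst

/-- The path is active relative to `[c, m]`: every inner transmitting node is in `m`, and every
inner collision node is in `c` or has a descendant in `c`.  A single edge is always active. -/
def IsActive (G : MixedGraph V) (c m : Set V) (n : ℕ) (x : ℕ → V) (e : ℕ → EdgeKind) : Prop :=
  ∀ j, j + 1 < n →
    (IsCollision e j → x (j + 1) ∈ c ∨ ∃ t ∈ c, G.Ancestor t (x (j + 1))) ∧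
    (¬ IsCollision e j → x (j + 1) ∈ m)

/-- There is an `ik`-path that is active relative to `[c, m]`, apart from the path that consists
of the single arrow `i ← k`. -/
def HasActivePathBesidesArrow (G : MixedGraph V) (c m : Set V) (i k : V) : Prop :=
  ∃ (n : ℕ) (x : ℕ → V) (e : ℕ → EdgeKind),
    x 0 = i ∧ x n = k ∧ G.IsPath n x e ∧ G.IsActive c m n x e ∧
      ¬ (n = 1 ∧ e 0 = EdgeKind.left)

end MixedGraph

/-! ## Partial closure of edge matrices and partial inversion of parameter matrices -/

/-- For a binary edge matrix `F` (as a relation), the positions `(i, k)` for which `F` has an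
`a`-line path `i, s, …, t, k`, with inner nodes `s, …, t` in `a`. -/
def LinePath {V : Type} (a : Set V) (F : V → V → Prop) (i k : V) : Prop :=
  ∃ s ∈ a, ∃ t ∈ a,
    F i s ∧ Relation.ReflTransGen (fun x y => x ∈ a ∧ y ∈ a ∧ F x y) s t ∧ F t k

/-- Partial closure `zer_a F`: all `a`-line paths are closed. -/
def partialClosure {V : Type} (a : Set V) (F : V → V → Prop) (i k : V) : Prop :=
  F i k ∨ LinePath a F i k

section PartialInversion

variable {V : Type} [Fintype V] [DecidableEq V]

open Classical in
/-- The inverse of the principal submatrix `F_aa`, extended by zeros. -/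
noncomputable def blockInv (a : Set V) (F : Matrix V V ℝ) : Matrix V V ℝ :=
  fun i k =>
    if h : i ∈ a ∧ k ∈ a then
      ((F.submatrix (Subtype.val : a → V) (Subtype.val : a → V))⁻¹) ⟨i, h.1⟩ ⟨k, h.2⟩
    else 0

open Classical in
/-- Partial inversion `inv_a F`, with blocks (for `b` the complement of `a`)
`F_aa⁻¹`, `-F_aa⁻¹ F_ab`, `F_ba F_aa⁻¹` and `F_bb - F_ba F_aa⁻¹ F_ab`. -/
noncomputable def partialInv (a : Set V) (F : Matrix V V ℝ) : Matrix V V ℝ :=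
  fun i k =>
    if i ∈ a then
      if k ∈ a then blockInv a F i k else -(blockInv a F * F) i k
    else
      if k ∈ a then (F * blockInv a F) i k else (F - F * blockInv a F * F) i k

end PartialInversion

/-! ## Parent graphs and their summary graphs -/

/-- A directed acyclic graph on `V = {0, …, d - 1}` with a compatible ordering of its nodes:
the parents `k` of `i` (`arrow i k`, that is `i ← k`) come after `i`.  Connectedness is not
required. -/
structure ParentGraph (d : ℕ) where
  arrow : Fin d → Fin d → Prop
  lt_of_arrow : ∀ i k, arrow i k → i < k

namespace ParentGraph

variable {d : ℕ} (G : ParentGraph d) (C M : Set (Fin d))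

/-- The parent graph as a graph all of whose edges are arrows. -/
def toMixed : MixedGraph (Fin d) where
  arrow := G.arrow
  dashed _ _ := False
  full _ _ := False

/-- `F`: the ancestors of `C` outside `C`. -/
def foster : Set (Fin d) := {j | j ∉ C ∧ ∃ t ∈ C, G.toMixed.Ancestor t j}

/-- `R = C ∪ F`. -/
def right : Set (Fin d) := C ∪ G.foster C

/-- `O = V \ R`. -/
def outsiders : Set (Fin d) := (G.right C)ᶜ

/-- `u = O \ M`. -/
def u : Set (Fin d) := G.outsiders C \ M

/-- `v = F \ M`. -/
def v : Set (Fin d) := G.foster C \ M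

/-- `p = O ∩ M`. -/
def p : Set (Fin d) := G.outsiders C ∩ M

/-- `q = F ∩ M`. -/
def q : Set (Fin d) := G.foster C ∩ M

/-- The edge matrix of the parent graph, with ones along the diagonal. -/
def edgeA (i k : Fin d) : Prop := i = k ∨ G.arrow i k

/-- The edge matrix `zer_p A`. -/
def edgeD : Fin d → Fin d → Prop := partialClosure (G.p C M) G.edgeA

/-- The edge matrix `A_RRᵀ A_RR` of the concentration graph of `Y_F` given `Y_C`. -/
def edgeConc (r s : Fin d) : Prop := ∃ t ∈ G.right C, G.edgeA t r ∧ G.edgeA t s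

/-- Its partial closure on `q`; the blocks `(q,q)`, `(q,v)` and `(v,v)` are those for
`cov(Y_q | Y_v, Y_C)`, for the regression of `Y_q` on `Y_v` given `Y_C`, and for the
concentration graph of `Y_v` given `Y_C`. -/
def edgeZ : Fin d → Fin d → Prop := partialClosure (G.q C M) (G.edgeConc C)

/-- An arrow `i ← k` of the summary graph (`i ∈ u`) is induced by marginalising and
conditioning: by closing a `p`-line path of arrows or, for `k ∈ v`, through nodes of `q`. -/
def InducedArrow (i k : Fin d) : Prop :=
  LinePath (G.p C M) G.edgeA i k ∨
    (k ∈ G.v C M ∧ ∃ s ∈ G.q C M, G.edgeD C M i s ∧ G.edgeZ C M s k)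

/-- The edge matrices `H_uu` (equal to `zer_p A`) and `H_uv`, for `i ∈ u` and `k ∈ u ∪ v`. -/
def edgeH (i k : Fin d) : Prop := G.edgeA i k ∨ G.InducedArrow C M i k

/-- The edge matrix `W_uu`, for `i, k ∈ u`. -/
def edgeW (i k : Fin d) : Prop :=
  i = k ∨ (∃ s ∈ G.p C M, G.edgeD C M i s ∧ G.edgeD C M k s) ∨
    ∃ s ∈ G.q C M, ∃ t ∈ G.q C M, G.edgeD C M i s ∧ G.edgeZ C M s t ∧ G.edgeD C M k t

/-- The summary graph in the node set `u ∪ v = V \ (C ∪ M)`, obtained from the parent graph by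
conditioning on `C` and marginalising over `M`. -/
def summary : MixedGraph (Fin d) where
  arrow i k := i ≠ k ∧ i ∈ G.u C M ∧ (k ∈ G.u C M ∨ k ∈ G.v C M) ∧ G.edgeH C M i k
  dashed i k := i ≠ k ∧ i ∈ G.u C M ∧ k ∈ G.u C M ∧ G.edgeW C M i k
  full i k := i ≠ k ∧ i ∈ G.v C M ∧ k ∈ G.v C M ∧ G.edgeZ C M i k

/-- `c_i`: the ancestors of `i` within `u`. -/
def anc (i : Fin d) : Set (Fin d) := {k | k ∈ G.u C M ∧ G.toMixed.Ancestor i k}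

/-- `m_i`: the nodes of `u` up to `i`, and the nodes of `u` in the past of `i` that are not in
`c_i`. -/
def marg (i : Fin d) : Set (Fin d) :=
  {j | j ∈ G.u C M ∧ j ≤ i} ∪ {j | j ∈ G.u C M ∧ i < j ∧ j ∉ G.anc C M i}

/-! ## Linear triangular systems and the parameters of the three models -/

/-- A linear triangular system generated over the parent graph: `Y` is a mean-centred
square-integrable random vector with `A Y = ε`, where `A` has unit diagonal and `A i k = 0` for
`i ≠ k` unless `i ← k`, and the residuals `ε` are uncorrelated with positive variances `Δ`.
Gaussian triangular systems are those for which moreover `Y` is Gaussian.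
The generating dependence of `Y_i` on `Y_k` is the coefficient `-A i k`. -/
structure IsLinearTriangularSystem {Ω : Type*} [MeasurableSpace Ω] (μ : Measure Ω)
    (A : Matrix (Fin d) (Fin d) ℝ) (Δ : Fin d → ℝ) (Y : Fin d → Ω → ℝ) : Prop where
  diag : ∀ i, A i i = 1
  zero : ∀ i k, i ≠ k → ¬ G.arrow i k → A i k = 0
  pos : ∀ i, 0 < Δ i
  memLp : ∀ i, MemLp (Y i) 2 μ
  mean : ∀ i, ∫ ω, Y i ω ∂μ = 0
  resid : ∀ i k, cov[fun ω => ∑ j, A i j * Y j ω, fun ω => ∑ j, A k j * Y j ω; μ] =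
    if i = k then Δ i else 0

section Parameters

variable (A : Matrix (Fin d) (Fin d) ℝ) (Δ : Fin d → ℝ)

/-- `D = inv_p A`. -/
noncomputable def paramD : Matrix (Fin d) (Fin d) ℝ := partialInv (G.p C M) A

open Classical in
/-- `A_RRᵀ Δ_RR⁻¹ A_RR`, the concentration matrix of `Y_R`; its block `(F, F)` is the
concentration matrix of `Y_F` given `Y_C`. -/
noncomputable def paramConc : Matrix (Fin d) (Fin d) ℝ :=
  fun r s => ∑ t, if t ∈ G.right C then A t r * (Δ t)⁻¹ * A t s else 0

/-- Its partial inversion on `q`; the blocks `(q,q)` and `(q,v)` are `cov(Y_q | Y_v, Y_C)` and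
the coefficient matrix of `Y_v` in the regression of `Y_q` on `Y_v` and `Y_C`. -/
noncomputable def paramQ : Matrix (Fin d) (Fin d) ℝ :=
  partialInv (G.q C M) (G.paramConc C A Δ)

open Classical in
/-- The equation parameters of the summary graph model,
`H_uu Y_u + H_uv Y_v = η_u` given `Y_C`: `H_uu = D_uu` and
`H_uv = D_uv + D_uq Π_{q|v.C}`. -/
noncomputable def paramH : Matrix (Fin d) (Fin d) ℝ :=
  fun i k =>
    if k ∈ G.v C M then
      G.paramD C M A i k + ∑ s, if s ∈ G.q C M then G.paramD C M A i s * G.paramQ C M A Δ s k else 0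
    else G.paramD C M A i k

open Classical in
/-- The residual covariance matrix of the summary graph model,
`W_uu = Δ_uu + D_up Δ_pp D_upᵀ + D_uq Σ_{qq|vC} D_uqᵀ`. -/
noncomputable def paramW : Matrix (Fin d) (Fin d) ℝ :=
  fun i k =>
    (if i = k then Δ i else 0)
      + (∑ s, if s ∈ G.p C M then G.paramD C M A i s * Δ s * G.paramD C M A k s else 0)
      + ∑ s, ∑ t, if s ∈ G.q C M ∧ t ∈ G.q C M then
          G.paramD C M A i s * G.paramQ C M A Δ s t * G.paramD C M A k t else 0

end Parameters

/-- The coefficient of `Y_k` in the linear least-squares regression of `Y_i` on `Y_b`, for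
`i ∉ b` and `k ∈ b`: the entry of `Σ_ib Σ_bb⁻¹`, where `Σ` is the covariance matrix of `Y`. -/
noncomputable def regressionCoef {Ω : Type*} [MeasurableSpace Ω] (μ : Measure Ω)
    (Y : Fin d → Ω → ℝ) (b : Set (Fin d)) (i k : Fin d) : ℝ :=
  partialInv b (Matrix.of fun r s => cov[Y r, Y s; μ]) i k

/-- The dependence of `Y_i` on `Y_k` in the MAG model in the nodes `V \ (C ∪ M)`: the coefficient
of `Y_k` in the regression of `Y_i` on `Y_{c_i}` and `Y_v`, given `Y_C`. -/
noncomputable def magDependence {Ω : Type*} [MeasurableSpace Ω] (μ : Measure Ω)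
    (Y : Fin d → Ω → ℝ) (i k : Fin d) : ℝ :=
  regressionCoef μ Y (G.anc C M i ∪ G.v C M ∪ C) i k

/-- The generating dependence `i ← k` is free of direct confounding.
In the summary graph the pair `i, k` has no double edge and the arrow `i ← k` is not also induced
by marginalising and conditioning; and the generating dependence is the one in the equation for
`Y_i` of the summary graph model, with residuals of `Y_i`, `Y_k` uncorrelated. -/
def FreeOfDirectConfounding (A : Matrix (Fin d) (Fin d) ℝ) (Δ : Fin d → ℝ) (i k : Fin d) : Prop :=
  (¬ (G.summary C M).dashed i k ∧ ¬ G.InducedArrow C M i k) ∧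
    G.paramH C M A Δ i k = A i k ∧ (k ∈ G.u C M → G.paramW C M A Δ i k = 0)

/-- The structural form of indirect confounding: the edge matrix product
`W_ic W_cc⁻ H_ck`, with `c = c_i`, of the summary graph is one, so that conditioning on `Y_{c_i}`
induces a further contribution to the arrow `i ← k` of the MAG. -/
def InducedByAncestors (i k : Fin d) : Prop :=
  ∃ j ∈ G.anc C M i, ∃ l ∈ G.anc C M i,
    G.edgeW C M i j ∧
      Relation.ReflTransGen
        (fun x y => x ∈ G.anc C M i ∧ y ∈ G.anc C M i ∧ G.edgeW C M x y) j l ∧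
      G.edgeH C M l k

/-- The dependence `i ← k` is free of indirect confounding: passing from the equation for `Y_i`
of the summary graph model to the regression of `Y_i` on `Y_{c_i}`, `Y_v` given `Y_C` of the MAG
model induces no further `ik`-edge and does not change the dependence of `Y_i` on `Y_k`. -/
def FreeOfIndirectConfounding {Ω : Type*} [MeasurableSpace Ω] (μ : Measure Ω)
    (A : Matrix (Fin d) (Fin d) ℝ) (Δ : Fin d → ℝ) (Y : Fin d → Ω → ℝ) (i k : Fin d) : Prop :=
  ¬ G.InducedByAncestors C M i k ∧
    G.magDependence C M μ Y i k = -G.paramH C M A Δ i k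

end ParentGraph

/-! ## From walks to paths -/

/-! The graphical part goes by contraposition: an induced edge yields an active path. An entry of
`edgeH`, `edgeW` or of the product behind `InducedByAncestors` is a chain of line paths, and a chain
can be traced edge by edge as an active walk. In the parent graph, nodes of `p` are passed as
transmitting nodes, nodes of `q` lie in `M` and have descendants in `C` and so can be passed in
every way, and an edge of the concentration graph may run through a common child in `R`, a collision
node that is in `C` or has a descendant there. In the summary graph, `InducedByAncestors` gives a
walk whose inner nodes are all collision nodes in `c_i`. Walks become paths by cutting loops, for
which `loopCuttable_activeAt` is the delicate case. The first edge survives the cutting; it is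
dashed or leads to a node of `M`, hence the path is not the arrow `i ← k` alone.

The link to parameters is `partialClosure_of_partialInv_ne_zero`: partial inversion has non-zero
entries only at positions of the partial closure, because inverses of block triangular matrices are
block triangular. Without an induced edge the extra terms in `paramH` and `paramW` therefore vanish.

The MAG dependence needs one computation, `partialInv_gram_eq`. The residuals `η_u` have covariance
matrix `W`, are uncorrelated with `Y_v` and `Y_C`, and their equations contain no variable of `M`.
With `c = c_i`, the vector `η_i - W_ic W_cc⁻¹ η_c` is uncorrelated with `η_c`, hence by back
substitution with `Y_c`, and it is a combination of `Y_i`, `Y_c`, `Y_v`, `Y_C`. It is thus the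
regression residual of `Y_i`, and `β_ik = -H_ik + W_ic W_cc⁻¹ H_ck`; a non-zero correction forces
`InducedByAncestors`. The algebra takes place among coordinate vectors with the covariance matrix as
a definite bilinear form, so that no almost-everywhere identities of random variables arise. -/

/-- The sequence `x` with the `l` terms from the index `a` on left out. -/
def skipSeq {α : Type} (a l : ℕ) (x : ℕ → α) (j : ℕ) : α := if j < a then x j else x (j + l)

theorem skipSeq_of_lt {α : Type} {a l j : ℕ} (x : ℕ → α) (h : j < a) : skipSeq a l x j = x j :=
  if_pos h

theorem skipSeq_of_le {α : Type} {a l j : ℕ} (x : ℕ → α) (h : a ≤ j) :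
    skipSeq a l x j = x (j + l) :=
  if_neg (not_lt.2 h)

namespace MixedGraph

variable {V : Type}

/-- A walk along edges of `G` that satisfies the condition `T` on the two edges at each of its
inner nodes.  Nodes may be repeated. -/
def IsWalk (G : MixedGraph V) (T : EdgeKind → V → EdgeKind → Prop) (n : ℕ) (x : ℕ → V)
    (e : ℕ → EdgeKind) : Prop :=
  (∀ j < n, G.HasEdge (x j) (e j) (x (j + 1))) ∧ ∀ j, j + 1 < n → T (e j) (x (j + 1)) (e (j + 1))

/-- Loops of walks with inner condition `T` can be cut out. -/
def LoopCuttable (G : MixedGraph V) (T : EdgeKind → V → EdgeKind → Prop) : Prop :=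
  ∀ (n : ℕ) (x : ℕ → V) (e : ℕ → EdgeKind) (a b : ℕ), G.IsWalk T n x e → a < b → b + 1 < n →
    x (a + 1) = x (b + 1) → T (e a) (x (a + 1)) (e (b + 1))

/-- Cutting a loop creates a single new junction, at `x a`, between the edge entering the loop and
the edge leaving it; `LoopCuttable` is the condition `T` there. If the loop ends the walk, the
junction disappears. -/
theorem IsWalk.skipSeq {G : MixedGraph V} {T : EdgeKind → V → EdgeKind → Prop}
    (hT : G.LoopCuttable T) {n : ℕ} {x : ℕ → V} {e : ℕ → EdgeKind} (h : G.IsWalk T n x e)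
    {a l : ℕ} (ha : 0 < a) (hl : 0 < l) (hn : a + l ≤ n) (hx : x a = x (a + l)) :
    G.IsWalk T (n - l) (skipSeq a l x) (skipSeq a l e) := by
  have hx' : ∀ j ≤ a, _root_.skipSeq a l x j = x j := by
    intro j hj
    rcases hj.lt_or_eq with h1 | rfl
    · exact skipSeq_of_lt x h1
    · rw [skipSeq_of_le x le_rfl, hx]
  refine ⟨fun j hj => ?_, fun j hj => ?_⟩
  · rcases lt_or_ge j a with h1 | h1
    · rw [hx' j h1.le, hx' (j + 1) h1, skipSeq_of_lt e h1]
      exact h.1 j (by omega)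
    · rw [skipSeq_of_le x h1, skipSeq_of_le e h1, skipSeq_of_le x (by omega : a ≤ j + 1),
        show j + 1 + l = j + l + 1 by omega]
      exact h.1 (j + l) (by omega)
  · rcases lt_trichotomy (j + 1) a with h1 | h1 | h1
    · rw [hx' _ h1.le, skipSeq_of_lt e h1, skipSeq_of_lt e (by omega)]
      exact h.2 j (by omega)
    · subst h1
      rw [hx' _ le_rfl, skipSeq_of_lt e (by omega), skipSeq_of_le e le_rfl,
        show j + 1 + l = j + l + 1 by omega]
      exact hT n x e j (j + l) h (by omega) (by omega)
        (by rw [hx, show j + 1 + l = j + l + 1 by omega])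
    · rw [skipSeq_of_le x h1.le, skipSeq_of_le e (by omega : a ≤ j), skipSeq_of_le e h1.le,
        show j + 1 + l = j + l + 1 by omega]
      exact h.2 (j + l) (by omega)

/-- A walk that does not return to its first node can be shortened to one with distinct nodes, with
the same first and last node, and the same first edge. -/
theorem IsWalk.exists_injOn {G : MixedGraph V} {T : EdgeKind → V → EdgeKind → Prop}
    (hT : G.LoopCuttable T) {n : ℕ} {x : ℕ → V} {e : ℕ → EdgeKind} (h : G.IsWalk T n x e)
    (hn : 0 < n) (h0 : ∀ j, 0 < j → j ≤ n → x j ≠ x 0) :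
    ∃ (n' : ℕ) (x' : ℕ → V) (e' : ℕ → EdgeKind), G.IsWalk T n' x' e' ∧ 0 < n' ∧
      Set.InjOn x' (Set.Iic n') ∧ x' 0 = x 0 ∧ x' n' = x n ∧ x' 1 = x 1 ∧ e' 0 = e 0 := by
  induction n using Nat.strong_induction_on generalizing x e with
  | _ n ih =>
    by_cases hinj : Set.InjOn x (Set.Iic n)
    · exact ⟨n, x, e, h, hn, hinj, rfl, rfl, rfl, rfl⟩
    obtain ⟨a, l, hl, hal, hx⟩ : ∃ a l, 0 < l ∧ a + l ≤ n ∧ x a = x (a + l) := by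
      simp only [Set.InjOn, Set.mem_Iic] at hinj
      push Not at hinj
      obtain ⟨a, ha, b, hb, hx, hab⟩ := hinj
      rcases lt_or_gt_of_ne hab with h1 | h1
      · exact ⟨a, b - a, by omega, by omega, by rw [hx]; congr 1; omega⟩
      · exact ⟨b, a - b, by omega, by omega, by rw [← hx]; congr 1; omega⟩
    have ha : 0 < a := by
      rcases Nat.eq_zero_or_pos a with rfl | h1
      · exact absurd hx.symm (h0 _ (by omega) hal)
      · exact h1
    have hx' : ∀ j ≤ a, _root_.skipSeq a l x j = x j := by
      intro j hj
      rcases hj.lt_or_eq with h1 | rfl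
      · exact skipSeq_of_lt x h1
      · rw [skipSeq_of_le x le_rfl, hx]
    obtain ⟨n', x', e', h1, h2, h3, h4, h5, h6, h7⟩ :=
      ih (n - l) (by omega) (h.skipSeq hT ha hl hal hx) (by omega) (by
        intro j hj hjn
        rw [hx' 0 (by omega)]
        rcases lt_or_ge j a with h1 | h1
        · rw [hx' j h1.le]; exact h0 j hj (by omega)
        · rw [skipSeq_of_le x h1]; exact h0 _ (by omega) (by omega))
    refine ⟨n', x', e', h1, h2, h3, ?_, ?_, ?_, ?_⟩
    · rw [h4, hx' 0 (by omega)]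
    · rw [h5, skipSeq_of_le x (by omega)]; congr 1; omega
    · rw [h6, hx' 1 (by omega)]
    · rw [h7, skipSeq_of_lt e (by omega)]

/-- `G.Reaches T i s₁ e₁ t e`: there is a walk with inner condition `T` from `i` to `t` that does
not return to `i`, starts with the edge `e₁` to `s₁` and ends with an edge of kind `e`. -/
inductive Reaches (G : MixedGraph V) (T : EdgeKind → V → EdgeKind → Prop) (i s₁ : V)
    (e₁ : EdgeKind) : V → EdgeKind → Prop
  | start : s₁ ≠ i → G.HasEdge i e₁ s₁ → Reaches G T i s₁ e₁ s₁ e₁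
  | step {s t : V} {e e' : EdgeKind} : Reaches G T i s₁ e₁ s e → T e s e' → G.HasEdge s e' t →
      t ≠ i → Reaches G T i s₁ e₁ t e'

theorem Reaches.exists_isWalk {G : MixedGraph V} {T : EdgeKind → V → EdgeKind → Prop} {i s₁ t : V}
    {e₁ e : EdgeKind} (h : G.Reaches T i s₁ e₁ t e) :
    ∃ (n : ℕ) (x : ℕ → V) (f : ℕ → EdgeKind), G.IsWalk T (n + 1) x f ∧ x 0 = i ∧ x (n + 1) = t ∧
      x 1 = s₁ ∧ f 0 = e₁ ∧ f n = e ∧ ∀ j, 0 < j → j ≤ n + 1 → x j ≠ i := by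
  induction h with
  | start h1 h2 =>
    refine ⟨0, fun j => if j = 0 then i else s₁, fun _ => e₁, ⟨?_, ?_⟩, ?_, ?_, ?_, rfl, rfl, ?_⟩
    · intro j hj
      obtain rfl : j = 0 := by omega
      simpa using h2
    · intro j hj; omega
    · simp
    · simp
    · simp
    · intro j hj _
      simpa [hj.ne'] using h1
  | @step s t e e' _ hTe hedge hti ih =>
    obtain ⟨n, x, f, ⟨hw1, hw2⟩, h0, hn, h1, hf0, hfn, hi⟩ := ih
    refine ⟨n + 1, fun j => if j ≤ n + 1 then x j else t, fun j => if j ≤ n then f j else e',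
      ⟨?_, ?_⟩, ?_, ?_, ?_, ?_, ?_, ?_⟩
    · intro j hj
      rcases Nat.lt_or_ge j (n + 1) with h2 | h2
      · simpa [show j ≤ n + 1 by omega, show j ≤ n by omega] using hw1 j h2
      · obtain rfl : j = n + 1 := by omega
        simpa [hn] using hedge
    · intro j hj
      rcases Nat.lt_or_ge (j + 1) (n + 1) with h2 | h2
      · simpa [show j ≤ n by omega, show j + 1 ≤ n by omega] using hw2 j h2
      · obtain rfl : j = n := by omega
        simpa [hn, hfn] using hTe
    · simpa using h0
    · simp
    · simpa using h1
    · simpa using hf0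
    · simp
    · intro j hj hjn
      rcases Nat.lt_or_ge (n + 1) j with h2 | h2
      · simpa [show ¬ j ≤ n + 1 by omega] using hti
      · simpa [h2] using hi j hj h2

/-- A walk that never returns to `i` keeps its first edge when loops are cut. If the shortened path
were the arrow `i ← k` alone, that arrow would already be the first edge of the walk. -/
theorem Reaches.hasActivePathBesidesArrow {G : MixedGraph V}
    {T : EdgeKind → V → EdgeKind → Prop} {c m : Set V} (hT : G.LoopCuttable T)
    (hact : ∀ n x e, G.IsWalk T n x e → G.IsActive c m n x e) {i s₁ k : V} {e₁ e : EdgeKind}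
    (h : G.Reaches T i s₁ e₁ k e) (h1 : ¬ (s₁ = k ∧ e₁ = EdgeKind.left)) :
    G.HasActivePathBesidesArrow c m i k := by
  obtain ⟨n, x, f, hw, hx0, hxn, hx1, hf0, -, hi⟩ := h.exists_isWalk
  obtain ⟨n', x', f', hw', hn', hinj, hx0', hxn', hx1', hf0'⟩ :=
    hw.exists_injOn hT (Nat.succ_pos n) (by rw [hx0]; exact hi)
  refine ⟨n', x', f', hx0'.trans hx0, hxn'.trans hxn, ⟨hn', hw'.1, hinj⟩, hact _ _ _ hw', ?_⟩
  rintro ⟨rfl, h2⟩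
  exact h1 ⟨by rw [← hx1, ← hx1', hxn', hxn], by rw [← hf0, ← hf0', h2]⟩

/-! ### Active walks and the cutting of their loops -/

/-- The condition at an inner node `s`, between edges `e` and `e'`, of a path that is active
relative to `[c, m]`. -/
def ActiveAt (G : MixedGraph V) (c m : Set V) (e : EdgeKind) (s : V) (e' : EdgeKind) : Prop :=
  (e.meetsSecond ∧ e'.meetsFirst → s ∈ c ∨ ∃ t ∈ c, G.Ancestor t s) ∧
    (¬ (e.meetsSecond ∧ e'.meetsFirst) → s ∈ m)

/-- If a walk of arrows leaves `x a` by `x a → x (a + 1)` and later contains an arrow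
`x b ← x (b + 1)`, then in between it has a collision node that is a descendant of `x a`. -/
theorem IsWalk.exists_collision {G : MixedGraph V} (hd : ∀ a b, ¬ G.dashed a b)
    (hf : ∀ a b, ¬ G.full a b) {T : EdgeKind → V → EdgeKind → Prop} {n : ℕ} {x : ℕ → V}
    {e : ℕ → EdgeKind} (h : G.IsWalk T n x e) {a b : ℕ} (hab : a ≤ b) (hb : b < n)
    (ha : e a = .right) (hl : e b = .left) :
    ∃ j, a ≤ j ∧ j + 1 ≤ b ∧ e j = .right ∧ e (j + 1) = .left ∧ G.Ancestor (x (j + 1)) (x a) := by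
  classical
  -- The collision sits just before the first index after `a` at which the walk stops following
  -- arrows forwards.
  have hex : ∃ j, a < j ∧ e j ≠ .right := by
    refine ⟨b, lt_of_le_of_ne hab ?_, by simp [hl]⟩
    rintro rfl
    rw [ha] at hl; cases hl
  obtain ⟨h1, h2⟩ := Nat.find_spec hex
  have h3 : Nat.find hex ≤ b := Nat.find_min' hex ⟨lt_of_le_of_ne hab (by
    rintro rfl
    rw [ha] at hl; cases hl), by simp [hl]⟩
  have h4 : ∀ j, a ≤ j → j < Nat.find hex → e j = .right := by
    intro j hj hj'
    rcases hj.lt_or_eq with h5 | rfl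
    · by_contra h6
      exact Nat.find_min hex hj' ⟨h5, h6⟩
    · exact ha
  generalize Nat.find hex = J at h1 h2 h3 h4
  obtain ⟨j, rfl⟩ : ∃ j, J = j + 1 := ⟨J - 1, by omega⟩
  have h5 : e (j + 1) = .left := by
    have := h.1 (j + 1) (by omega)
    cases h6 : e (j + 1) with
    | left => rfl
    | right => exact absurd h6 h2
    | dashed => rw [h6] at this; exact absurd this (hd _ _)
    | full => rw [h6] at this; exact absurd this (hf _ _)
  refine ⟨j, by omega, h3, h4 j (by omega) (by omega), h5, ?_⟩
  have key : ∀ l, a + l ≤ j → G.Ancestor (x (a + l + 1)) (x a) := by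
    intro l
    induction l with
    | zero =>
      intro _
      have := h.1 a (by omega)
      rw [ha] at this
      exact Relation.TransGen.single this
    | succ l ihl =>
      intro hlb
      have h2 := h.1 (a + (l + 1)) (by omega)
      rw [h4 _ (by omega) (by omega)] at h2
      exact Relation.TransGen.head h2 (ihl (by omega))
  have := key (j - a) (by omega)
  rwa [show a + (j - a) = j by omega] at this

/-- Let a loop at `s` be cut. If the new junction is transmitting, the two old passages of `s`
cannot both be collisions, so `s ∈ m`. If it is a collision and neither old passage was one, the
loop leaves `s` along an outgoing arrow and returns against one; in between it has a collision node
that descends from `s`, and whatever makes that node active makes `s` active. -/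
theorem loopCuttable_activeAt {G : MixedGraph V} (hd : ∀ a b, ¬ G.dashed a b)
    (hf : ∀ a b, ¬ G.full a b) (c m : Set V) : G.LoopCuttable (G.ActiveAt c m) := by
  intro n x e a b hw hab hb hx
  have hA := hw.2 a (by omega)
  have hB := hw.2 b hb
  rw [← hx] at hB
  have hlr : ∀ j < n, e j = .left ∨ e j = .right := by
    intro j hj
    have := hw.1 j hj
    cases h6 : e j with
    | left => exact .inl rfl
    | right => exact .inr rfl
    | dashed => rw [h6] at this; exact absurd this (hd _ _)
    | full => rw [h6] at this; exact absurd this (hf _ _)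
  refine ⟨fun h => ?_, fun h => ?_⟩
  · by_cases h1 : (e (a + 1)).meetsFirst
    · exact hA.1 ⟨h.1, h1⟩
    by_cases h2 : (e b).meetsSecond
    · exact hB.1 ⟨h2, h.2⟩
    have h3 : e (a + 1) = .right := (hlr (a + 1) (by omega)).resolve_left (by
      intro h4; rw [h4] at h1; exact h1 trivial)
    have h4 : e b = .left := (hlr b (by omega)).resolve_right (by
      intro h4; rw [h4] at h2; exact h2 trivial)
    obtain ⟨j, hj1, hj2, hj3, hj4, hj5⟩ :=
      hw.exists_collision hd hf (by omega) (by omega) h3 h4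
    right
    rcases (hw.2 j (by omega)).1 (by rw [hj3, hj4]; exact ⟨trivial, trivial⟩) with h6 | ⟨t, ht, h6⟩
    · exact ⟨_, h6, hj5⟩
    · exact ⟨t, ht, h6.trans hj5⟩
  · by_cases h1 : (e a).meetsSecond ∧ (e (a + 1)).meetsFirst
    · exact hB.2 fun h2 => h ⟨h1.1, h2.2⟩
    · exact hA.2 h1

end MixedGraph

/-! ### Ancestors and edge matrices of the parent graph -/

namespace ParentGraph

variable {d : ℕ} {G : ParentGraph d} {C M : Set (Fin d)}

theorem lt_of_ancestor {i k : Fin d} (h : G.toMixed.Ancestor i k) : i < k := by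
  induction h with
  | single h => exact G.lt_of_arrow _ _ h
  | tail _ h ih => exact ih.trans (G.lt_of_arrow _ _ h)

theorem mem_right_iff {j : Fin d} :
    j ∈ G.right C ↔ j ∈ C ∨ ∃ t ∈ C, G.toMixed.Ancestor t j := by
  simp only [right, foster, Set.mem_union, Set.mem_ofPred_eq]
  tauto

/-- `R` is ancestral. This is what makes `A_RO` vanish and lets `Y_R` be recovered from the
residuals in `R` by back substitution. -/
theorem mem_right_of_arrow {r t : Fin d} (hr : r ∈ G.right C) (h : G.arrow r t) :
    t ∈ G.right C := by
  have h' : G.toMixed.Ancestor r t := Relation.TransGen.single h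
  rw [mem_right_iff] at hr ⊢
  right
  rcases hr with hr | ⟨s, hs, hsr⟩
  · exact ⟨r, hr, h'⟩
  · exact ⟨s, hs, hsr.trans h'⟩

theorem q_subset_right : G.q C M ⊆ G.right C := fun _ h => .inr h.1

theorem v_subset_right : G.v C M ⊆ G.right C := fun _ h => .inr h.1

theorem mem_u_or_mem_v {k : Fin d} (hk : k ∉ C ∪ M) : k ∈ G.u C M ∨ k ∈ G.v C M := by
  simp only [Set.mem_union, not_or] at hk
  by_cases h : k ∈ G.foster C
  · exact .inr ⟨h, hk.2⟩
  · exact .inl ⟨fun h' => h'.elim hk.1 h, hk.2⟩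

theorem edgeA_refl (i : Fin d) : G.edgeA i i := .inl rfl

theorem edgeConc_refl {r : Fin d} (h : r ∈ G.right C) : G.edgeConc C r r :=
  ⟨r, h, .inl rfl, .inl rfl⟩

theorem reflTransGen_of_edgeA {i k : Fin d} (h : G.edgeA i k) :
    Relation.ReflTransGen G.arrow i k := by
  rcases h with rfl | h
  · exact .refl
  · exact .single h

theorem reflTransGen_of_partialClosure {a : Set (Fin d)} {i k : Fin d}
    (h : partialClosure a G.edgeA i k) : Relation.ReflTransGen G.arrow i k := by
  rcases h with h | ⟨s, -, t, -, h1, h2, h3⟩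
  · exact reflTransGen_of_edgeA h
  · refine (reflTransGen_of_edgeA h1).trans (.trans ?_ (reflTransGen_of_edgeA h3))
    clear h1 h3
    induction h2 with
    | refl => exact .refl
    | tail _ h ih => exact ih.trans (reflTransGen_of_edgeA h.2.2)

theorem eq_or_ancestor_of_edgeD {i k : Fin d} (h : G.edgeD C M i k) :
    i = k ∨ G.toMixed.Ancestor i k := by
  rcases Relation.reflTransGen_iff_eq_or_transGen.1 (reflTransGen_of_partialClosure h) with h | h
  · exact .inl h.symm
  · exact .inr h

/-! ## Induced edges and active paths -/

section Walks

variable {i s₁ : Fin d} {e₁ : EdgeKind}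

/-- Walks from `i` whose inner nodes are those of an active path of the parent graph. -/
abbrev ReachesActive (G : ParentGraph d) (C M : Set (Fin d)) (i s₁ : Fin d) (e₁ : EdgeKind)
    (t : Fin d) (e : EdgeKind) : Prop :=
  G.toMixed.Reaches (G.toMixed.ActiveAt C M) i s₁ e₁ t e

/-- A node of `q` is marginalised over and also has a descendant in `C`, so it is active both as
transmitting and as collision node. -/
theorem activeAt_of_mem_q {s : Fin d} (hs : s ∈ G.q C M) (e e' : EdgeKind) :
    G.toMixed.ActiveAt C M e s e' :=
  ⟨fun _ => mem_right_iff.1 (q_subset_right hs), fun _ => hs.2⟩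

theorem activeAt_right {s : Fin d} (hs : s ∈ M) (e : EdgeKind) :
    G.toMixed.ActiveAt C M e s .right :=
  ⟨fun h => h.2.elim, fun _ => hs⟩

theorem activeAt_left_left {s : Fin d} (hs : s ∈ M) : G.toMixed.ActiveAt C M .left s .left :=
  ⟨fun h => h.1.elim, fun _ => hs⟩

/-- A node in `p ∪ q` that is reached from `i ∈ u` along an arrow of `zer_p A`. -/
theorem exists_reachesActive_of_edgeD (hi : i ∈ G.u C M) {s : Fin d} (hs : s ∈ M)
    (h : G.edgeD C M i s) : ∃ s₁ ∈ M, G.ReachesActive C M i s₁ .left s .left := by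
  have hM : ∀ {t}, t ∈ M → t ≠ i := fun ht h => hi.2 (h ▸ ht)
  have hA : ∀ {t}, t ∈ M → G.edgeA i t → G.ReachesActive C M i t .left t .left := fun ht h =>
    .start (hM ht) (h.resolve_left (hM ht).symm)
  rcases h with h | ⟨a, ha, b, hb, h1, h2, h3⟩
  · exact ⟨s, hs, hA hs h⟩
  · have hstep : ∀ {x y : Fin d}, x ∈ M → y ∈ M → G.edgeA x y →
        G.ReachesActive C M i a .left x .left → G.ReachesActive C M i a .left y .left := by
      intro x y hx hy hxy hr
      rcases hxy with rfl | hxy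
      · exact hr
      · exact hr.step (activeAt_left_left hx) hxy (hM hy)
    refine ⟨a, ha.2, hstep hb.2 hs h3 ?_⟩
    clear h3
    induction h2 with
    | refl => exact hA ha.2 h1
    | tail _ h ih => exact hstep h.1.2 h.2.1.2 h.2.2 (ih h.1)

/-- From a node of `M`, a walk can be continued along a reversed arrow of `zer_p A`. -/
theorem ReachesActive.edgeD_right (hi : i ∈ G.u C M) {s k : Fin d} (hs : s ∈ M) (hk : k ≠ i)
    (h : ∃ e, G.ReachesActive C M i s₁ e₁ s e) (hks : G.edgeD C M k s) :
    ∃ e, G.ReachesActive C M i s₁ e₁ k e := by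
  have hM : ∀ {t}, t ∈ M → t ≠ i := fun ht h => hi.2 (h ▸ ht)
  have hstep : ∀ {x y : Fin d}, x ∈ M → y ≠ i → G.edgeA y x →
      (∃ e, G.ReachesActive C M i s₁ e₁ x e) → ∃ e, G.ReachesActive C M i s₁ e₁ y e := by
    rintro x y hx hy hxy ⟨e, hr⟩
    rcases hxy with rfl | hxy
    · exact ⟨e, hr⟩
    · exact ⟨_, hr.step (activeAt_right hx e) (show G.toMixed.HasEdge x .right y from hxy) hy⟩
  rcases hks with hks | ⟨a, ha, b, hb, h1, h2, h3⟩
  · exact hstep hs hk hks h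
  · refine hstep ha.2 hk h1 ?_
    clear h1
    induction h2 using Relation.ReflTransGen.head_induction_on with
    | refl => exact hstep hs (hM hb.2) h3 h
    | head h _ ih => exact hstep h.2.1.2 (hM h.1.2) h.2.2 (ih h.2.1)

/-- From a node of `q`, a walk can be continued along an edge of the concentration graph. -/
theorem ReachesActive.edgeConc (hi : i ∈ G.u C M) {s k : Fin d} (hs : s ∈ G.q C M) (hk : k ≠ i)
    (h : ∃ e, G.ReachesActive C M i s₁ e₁ s e) (hsk : G.edgeConc C s k) :
    ∃ e, G.ReachesActive C M i s₁ e₁ k e := by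
  obtain ⟨e, hr⟩ := h
  obtain ⟨t, ht, hts, htk⟩ := hsk
  have hti : t ≠ i := fun h => hi.1 (h ▸ ht)
  rcases hts with rfl | hts
  · rcases htk with rfl | htk
    · exact ⟨e, hr⟩
    · exact ⟨.left, hr.step (activeAt_of_mem_q hs _ _) htk hk⟩
  -- The walk runs down to the common child `t` and up again to `k`. Since `t ∈ R`, it may be passed
  -- as a collision node, and it differs from `i ∈ u`.
  · have hr' : G.ReachesActive C M i s₁ e₁ t .right :=
      hr.step (activeAt_of_mem_q hs _ _) (show G.toMixed.HasEdge s .right t from hts) hti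
    rcases htk with rfl | htk
    · exact ⟨_, hr'⟩
    · exact ⟨.left, hr'.step ⟨fun _ => mem_right_iff.1 ht, fun h => (h ⟨trivial, trivial⟩).elim⟩
        htk hk⟩

theorem ReachesActive.edgeZ (hi : i ∈ G.u C M) {s k : Fin d} (hs : s ∈ G.q C M) (hk : k ≠ i)
    (h : ∃ e, G.ReachesActive C M i s₁ e₁ s e) (hsk : G.edgeZ C M s k) :
    ∃ e, G.ReachesActive C M i s₁ e₁ k e := by
  have hq : ∀ {t}, t ∈ G.q C M → t ≠ i := fun ht h => hi.2 (h ▸ ht.2)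
  rcases hsk with hsk | ⟨a, ha, b, hb, h1, h2, h3⟩
  · exact edgeConc hi hs hk h hsk
  · refine edgeConc hi hb hk ?_ h3
    clear h3
    induction h2 with
    | refl => exact edgeConc hi hs (hq ha) h h1
    | tail _ h' ih => exact edgeConc hi h'.1 (hq h'.2.1) (ih h'.1) h'.2.2

theorem ReachesActive.hasActivePathBesidesArrow {k : Fin d}
    (h : ∃ e, G.ReachesActive C M i s₁ e₁ k e) (h1 : ¬ (s₁ = k ∧ e₁ = .left)) :
    G.toMixed.HasActivePathBesidesArrow C M i k := by
  obtain ⟨e, h⟩ := h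
  exact MixedGraph.Reaches.hasActivePathBesidesArrow
    (MixedGraph.loopCuttable_activeAt (fun _ _ h => h) (fun _ _ h => h) C M)
    (fun _ _ _ hw => hw.2) h h1

/-- An arrow that is induced by marginalising and conditioning comes from an active path of the
parent graph. -/
theorem hasActivePath_of_inducedArrow (hi : i ∈ G.u C M) {k : Fin d} (hik : k ≠ i) (hk : k ∉ M)
    (h : G.InducedArrow C M i k) : G.toMixed.HasActivePathBesidesArrow C M i k := by
  rcases h with ⟨s, hs, t, ht, h1, h2, h3⟩ | ⟨-, s, hs, h1, h2⟩
  · have hD : G.edgeD C M i t := by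
      -- Without its last edge, the line path is an edge of `zer_p A` from `i` to `t`.
      rcases Relation.ReflTransGen.cases_tail h2 with rfl | ⟨r, h4, h5⟩
      · exact .inl h1
      · exact .inr ⟨s, hs, r, h5.1, h1, h4, h5.2.2⟩
    obtain ⟨s₁, hs₁, hr⟩ := exists_reachesActive_of_edgeD hi ht.2 hD
    rcases h3 with rfl | h3
    · exact absurd ht.2 hk
    -- The walk begins with an arrow from a node of `M`, whereas `k ∉ M`.
    · exact ReachesActive.hasActivePathBesidesArrow
        ⟨_, hr.step (activeAt_left_left ht.2) h3 hik⟩ fun h => hk (h.1 ▸ hs₁)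
  · obtain ⟨s₁, hs₁, hr⟩ := exists_reachesActive_of_edgeD hi hs.2 h1
    exact ReachesActive.hasActivePathBesidesArrow (ReachesActive.edgeZ hi hs hik ⟨_, hr⟩ h2)
      fun h => hk (h.1 ▸ hs₁)

/-- A dashed line of the summary graph comes from an active path of the parent graph. -/
theorem hasActivePath_of_edgeW (hi : i ∈ G.u C M) {k : Fin d} (hik : k ≠ i) (hk : k ∉ M)
    (h : G.edgeW C M i k) : G.toMixed.HasActivePathBesidesArrow C M i k := by
  rcases h with rfl | ⟨s, hs, h1, h2⟩ | ⟨s, hs, t, ht, h1, h2, h3⟩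
  · exact absurd rfl hik
  · obtain ⟨s₁, hs₁, hr⟩ := exists_reachesActive_of_edgeD hi hs.2 h1
    exact ReachesActive.hasActivePathBesidesArrow
      (ReachesActive.edgeD_right hi hs.2 hik ⟨_, hr⟩ h2) fun h => hk (h.1 ▸ hs₁)
  · obtain ⟨s₁, hs₁, hr⟩ := exists_reachesActive_of_edgeD hi hs.2 h1
    have hti : t ≠ i := fun h => hi.2 (h ▸ ht.2)
    exact ReachesActive.hasActivePathBesidesArrow
      (ReachesActive.edgeD_right hi ht.2 hik (ReachesActive.edgeZ hi hs hti ⟨_, hr⟩ h2) h3)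
      fun h => hk (h.1 ▸ hs₁)

end Walks

theorem ne_of_mem_anc {i j : Fin d} (h : j ∈ G.anc C M i) : j ≠ i :=
  (lt_of_ancestor h.2).ne'

/-- An edge induced by conditioning on `Y_{c_i}` comes from an active path of the summary
graph. -/
theorem hasActivePath_of_inducedByAncestors {i k : Fin d} (hi : i ∈ G.u C M) (hik : k ≠ i)
    (hk : k ∈ G.u C M ∨ k ∈ G.v C M) (h : G.InducedByAncestors C M i k) :
    (G.summary C M).HasActivePathBesidesArrow (G.anc C M i) (G.marg C M i) i k := by
  obtain ⟨j, hj, l, hl, hij, hjl, hlk⟩ := h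
  -- Every inner node is required to be a collision node in `c_i`. This implies activity and splits
  -- into a condition on each adjacent edge, so loops can be cut at once.
  let T : EdgeKind → Fin d → EdgeKind → Prop := fun e s e' =>
    s ∈ G.anc C M i ∧ e.meetsSecond ∧ e'.meetsFirst
  have hT : (G.summary C M).LoopCuttable T := fun n x e a b hw hab hb hx =>
    ⟨(hw.2 a (by omega)).1, (hw.2 a (by omega)).2.1, (hw.2 b hb).2.2⟩
  have hact : ∀ n x e, (G.summary C M).IsWalk T n x e →
      (G.summary C M).IsActive (G.anc C M i) (G.marg C M i) n x e := fun n x e hw j hj =>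
    ⟨fun _ => .inl (hw.2 j hj).1, fun h => absurd (hw.2 j hj).2 h⟩
  have hr : (G.summary C M).Reaches T i j .dashed l .dashed := by
    clear hlk
    induction hjl with
    | refl => exact .start (ne_of_mem_anc hj) ⟨(ne_of_mem_anc hj).symm, hi, hj.1, hij⟩
    | @tail x y _ h ih =>
      -- The ones on the diagonal of `W` are no edges of the graph; such steps are dropped.
      by_cases hxy : x = y
      · exact hxy ▸ ih h.1
      · exact (ih h.1).step ⟨h.1, trivial, trivial⟩ ⟨hxy, h.1.1, h.2.1.1, h.2.2⟩
          (ne_of_mem_anc hl)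
  -- The unit diagonal of `H` allows `l = k`; the dashed lines then already end at `k`.
  by_cases hlk' : l = k
  · exact (hlk' ▸ hr).hasActivePathBesidesArrow hT hact fun h => by cases h.2
  · exact (hr.step (t := k) (e' := .left) ⟨hl, trivial, trivial⟩ ⟨hlk', hl.1, hk, hlk⟩
      hik).hasActivePathBesidesArrow hT hact fun h => by cases h.2

end ParentGraph

/-! ## Partial inversion -/

section PartialInversion

variable {V : Type} [Fintype V] [DecidableEq V] {a : Set V} {F : Matrix V V ℝ}

open Classical in
/-- The principal submatrix `F_aa` is nonsingular. -/
def IsRegularOn (a : Set V) (F : Matrix V V ℝ) : Prop :=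
  IsUnit (F.submatrix (Subtype.val : a → V) (Subtype.val : a → V)).det

/-- Trivial kernel of `F_aa`, stated for vectors on all of `V` that vanish outside `a`, so that no
sums over subtypes are needed later. -/
theorem isRegularOn_of_forall
    (h : ∀ x : V → ℝ, (∀ i ∉ a, x i = 0) → (∀ i ∈ a, ∑ j, F i j * x j = 0) → ∀ i, x i = 0) :
    IsRegularOn a F := by
  classical
  unfold IsRegularOn
  by_contra hdet
  rw [isUnit_iff_ne_zero, not_not] at hdet
  obtain ⟨w, hw, hw0⟩ := Matrix.exists_mulVec_eq_zero_iff.2 hdet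
  refine hw (funext fun i => ?_)
  have := h (fun j => if hj : j ∈ a then w ⟨j, hj⟩ else 0) (fun i hi => by simp [hi])
    (fun i hi => ?_) i
  · simpa using this
  · rw [Finset.sum_congr_set a _ (fun j => F i j * w j) (fun j hj => by simp [hj])
      (fun j hj => by simp [hj])]
    exact congrFun hw0 ⟨i, hi⟩

theorem IsRegularOn.transpose (h : IsRegularOn a F) : IsRegularOn a F.transpose := by
  classical
  rw [IsRegularOn, ← Matrix.transpose_submatrix, Matrix.det_transpose]
  exact h

theorem blockInv_of_notMem_left {i : V} (hi : i ∉ a) (k : V) : blockInv a F i k = 0 := by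
  simp [blockInv, hi]

theorem blockInv_of_notMem_right {k : V} (hk : k ∉ a) (i : V) : blockInv a F i k = 0 := by
  simp [blockInv, hk]

theorem blockInv_transpose (i k : V) : blockInv a F.transpose i k = blockInv a F k i := by
  classical
  by_cases h : i ∈ a ∧ k ∈ a
  · rw [blockInv, blockInv, dif_pos h, dif_pos h.symm, ← Matrix.transpose_submatrix,
      ← Matrix.transpose_nonsing_inv]
    rfl
  · rw [blockInv, blockInv, dif_neg h, dif_neg fun h' => h h'.symm]

theorem sum_mul_blockInv (hF : IsRegularOn a F) {i k : V} (hi : i ∈ a) (hk : k ∈ a) :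
    ∑ j, F i j * blockInv a F j k = if i = k then 1 else 0 := by
  classical
  rw [Finset.sum_congr_set a _ (fun j => F i j *
    ((F.submatrix (Subtype.val : a → V) (Subtype.val : a → V))⁻¹) j ⟨k, hk⟩)
    (fun j hj => by rw [blockInv, dif_pos ⟨hj, hk⟩])
    (fun j hj => by rw [blockInv_of_notMem_left hj, mul_zero])]
  have := congrFun (congrFun (Matrix.mul_nonsing_inv _ hF) ⟨i, hi⟩) ⟨k, hk⟩
  rw [Matrix.one_apply] at this
  simpa [Matrix.mul_apply] using this

theorem sum_blockInv_mul (hF : IsRegularOn a F) {i k : V} (hi : i ∈ a) (hk : k ∈ a) :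
    ∑ j, blockInv a F i j * F j k = if i = k then 1 else 0 := by
  have := sum_mul_blockInv hF.transpose hk hi
  simp only [blockInv_transpose, Matrix.transpose_apply] at this
  simp only [mul_comm (blockInv a F i _), this, eq_comm]

/-- The inverse of `F_aa` has non-zero entries only at positions that are joined in the transitive
closure of the edge matrix of `F_aa`. -/
theorem reflTransGen_of_blockInv_ne_zero {E : V → V → Prop} (hF : IsRegularOn a F)
    (hE : ∀ i ∈ a, ∀ k ∈ a, F i k ≠ 0 → E i k) {s t : V} (h : blockInv a F s t ≠ 0) :
    s ∈ a ∧ t ∈ a ∧ Relation.ReflTransGen (fun x y => x ∈ a ∧ y ∈ a ∧ E x y) s t := by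
  classical
  have hs : s ∈ a := by_contra fun hs => h (blockInv_of_notMem_left hs t)
  have ht : t ∈ a := by_contra fun ht => h (blockInv_of_notMem_right ht s)
  refine ⟨hs, ht, by_contra fun hst => h ?_⟩
  rw [blockInv, dif_pos ⟨hs, ht⟩]
  set N := F.submatrix (Subtype.val : a → V) (Subtype.val : a → V) with hN
  -- Two blocks: nodes reachable from `s` and the others. No non-zero entry leads from a reachable
  -- row to an unreachable column, and the inverse inherits this; `t` is unreachable from `s`.
  let b : a → ℕ := fun j =>
    if Relation.ReflTransGen (fun x y => x ∈ a ∧ y ∈ a ∧ E x y) s j then 1 else 0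
  have hb : N.BlockTriangular b := by
    intro i j hij
    by_contra hne
    have hEij := hE i i.2 j j.2 hne
    by_cases h1 : Relation.ReflTransGen (fun x y => x ∈ a ∧ y ∈ a ∧ E x y) s i
    · simp [b, h1, h1.tail ⟨i.2, j.2, hEij⟩] at hij
    · simp [b, h1] at hij
  let _ := Matrix.invertibleOfIsUnitDet N hF
  refine Matrix.blockTriangular_inv_of_blockTriangular hb ?_
  simp only [b, if_neg hst, if_pos Relation.ReflTransGen.refl]
  exact one_pos

variable {E : V → V → Prop}

theorem linePath_of_sum_ne_zero (hF : IsRegularOn a F) (hE : ∀ i k, F i k ≠ 0 → E i k) {i k : V}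
    (h : (F * blockInv a F * F) i k ≠ 0) : LinePath a E i k := by
  rw [Matrix.mul_apply] at h
  obtain ⟨t, -, ht⟩ := Finset.exists_ne_zero_of_sum_ne_zero h
  have h1 := left_ne_zero_of_mul ht
  rw [Matrix.mul_apply] at h1
  obtain ⟨s, -, hs⟩ := Finset.exists_ne_zero_of_sum_ne_zero h1
  obtain ⟨h2, h3, h4⟩ := reflTransGen_of_blockInv_ne_zero hF (fun i _ k _ => hE i k)
    (right_ne_zero_of_mul hs)
  exact ⟨s, h2, t, h3, hE _ _ (left_ne_zero_of_mul hs), h4, hE _ _ (right_ne_zero_of_mul ht)⟩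

theorem partialInv_eq_of_not_linePath (hF : IsRegularOn a F) (hE : ∀ i k, F i k ≠ 0 → E i k)
    {i k : V} (hi : i ∉ a) (hk : k ∉ a) (h : ¬ LinePath a E i k) :
    partialInv a F i k = F i k := by
  have h0 : (F * blockInv a F * F) i k = 0 := by_contra fun h' => h (linePath_of_sum_ne_zero hF hE h')
  rw [partialInv, if_neg hi, if_neg hk, Matrix.sub_apply, h0, sub_zero]

/-- Partial closure gives the structural zeros of partial inversion. -/
theorem partialClosure_of_partialInv_ne_zero (hF : IsRegularOn a F)
    (hE : ∀ i k, F i k ≠ 0 → E i k) (hrefl : ∀ i ∈ a, E i i) {i k : V}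
    (h : partialInv a F i k ≠ 0) : partialClosure a E i k := by
  by_cases hi : i ∈ a <;> by_cases hk : k ∈ a
  · rw [partialInv, if_pos hi, if_pos hk] at h
    obtain ⟨-, -, h1⟩ := reflTransGen_of_blockInv_ne_zero hF (fun i _ k _ => hE i k) h
    -- End nodes in `a` also serve as inner nodes, which uses the ones on the diagonal.
    exact .inr ⟨i, hi, k, hk, hrefl i hi, h1, hrefl k hk⟩
  · rw [partialInv, if_pos hi, if_neg hk, neg_ne_zero, Matrix.mul_apply] at h
    obtain ⟨t, -, ht⟩ := Finset.exists_ne_zero_of_sum_ne_zero h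
    obtain ⟨-, h2, h1⟩ := reflTransGen_of_blockInv_ne_zero hF (fun i _ k _ => hE i k)
      (left_ne_zero_of_mul ht)
    exact .inr ⟨i, hi, t, h2, hrefl i hi, h1, hE _ _ (right_ne_zero_of_mul ht)⟩
  · rw [partialInv, if_neg hi, if_pos hk, Matrix.mul_apply] at h
    obtain ⟨s, -, hs⟩ := Finset.exists_ne_zero_of_sum_ne_zero h
    obtain ⟨h2, -, h1⟩ := reflTransGen_of_blockInv_ne_zero hF (fun i _ k _ => hE i k)
      (right_ne_zero_of_mul hs)
    exact .inr ⟨s, h2, k, hk, hE _ _ (left_ne_zero_of_mul hs), h1, hrefl k hk⟩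
  · by_cases h1 : LinePath a E i k
    · exact .inr h1
    · rw [partialInv_eq_of_not_linePath hF hE hi hk h1] at h
      exact .inl (hE i k h)

/-- The coefficients of the linear least-squares regression on `Y_b` are determined by the normal
equations. -/
theorem partialInv_eq_of_normal_equations {b : Set V} {S : Matrix V V ℝ} (hS : IsRegularOn b S)
    {i k : V} (hi : i ∉ b) (hk : k ∈ b) (γ : V → ℝ) (hγ : ∀ j ∉ b, γ j = 0)
    (h : ∀ r ∈ b, ∑ j, γ j * S j r = S i r) : partialInv b S i k = γ k := by
  rw [partialInv, if_neg hi, if_pos hk, Matrix.mul_apply]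
  have h1 : ∀ r, S i r * blockInv b S r k = ∑ j, γ j * (S j r * blockInv b S r k) := by
    intro r
    by_cases hr : r ∈ b
    · rw [← h r hr, Finset.sum_mul]
      exact Finset.sum_congr rfl fun j _ => by ring
    · simp [blockInv_of_notMem_left hr]
  rw [Finset.sum_congr rfl fun r _ => h1 r, Finset.sum_comm, Finset.sum_eq_single k]
  · rw [← Finset.mul_sum, sum_mul_blockInv hS hk hk, if_pos rfl, mul_one]
  · intro j _ hjk
    by_cases hj : j ∈ b
    · rw [← Finset.mul_sum, sum_mul_blockInv hS hj hk, if_neg hjk, mul_zero]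
    · simp [hγ j hj]
  · simp

end PartialInversion

/-- Back substitution in a system of equations that is unit triangular on `S`. -/
theorem eq_zero_of_triangular {d : ℕ} (S : Set (Fin d)) (H : Matrix (Fin d) (Fin d) ℝ)
    (f : Fin d → ℝ) (h1 : ∀ r ∈ S, H r r = 1)
    (h2 : ∀ r ∈ S, ∀ j, j ≠ r → H r j ≠ 0 → f j = 0 ∨ j ∈ S ∧ r < j)
    (h3 : ∀ r ∈ S, ∑ j, H r j * f j = 0) : ∀ r ∈ S, f r = 0 := by
  intro r
  induction r using WellFoundedGT.induction with
  | _ r ih =>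
    intro hr
    have := h3 r hr
    rw [Finset.sum_eq_single r, h1 r hr, one_mul] at this
    · exact this
    · intro j _ hj
      by_cases h : H r j = 0
      · rw [h, zero_mul]
      · rcases h2 r hr j hj h with h' | ⟨h', hlt⟩
        · rw [h', mul_zero]
        · rw [ih j hlt h', mul_zero]
    · simp

namespace ParentGraph

variable {d : ℕ} {G : ParentGraph d} {C M : Set (Fin d)}

/-! ## Triangular systems in a real vector space with an inner product -/

/-- A linear triangular system of vectors `y i` of a real vector space with a symmetric, definite
bilinear form `Q` in the place of the covariance. -/
structure IsTriangularSystem {E : Type*} [AddCommGroup E] [Module ℝ E] (G : ParentGraph d)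
    (A : Matrix (Fin d) (Fin d) ℝ) (Δ : Fin d → ℝ) (Q : LinearMap.BilinForm ℝ E)
    (y : Fin d → E) : Prop where
  diag : ∀ i, A i i = 1
  zero : ∀ i k, i ≠ k → ¬ G.arrow i k → A i k = 0
  pos : ∀ i, 0 < Δ i
  symm : ∀ a b, Q a b = Q b a
  definite : ∀ a, Q a a = 0 → a = 0
  resid : ∀ i k, Q (∑ j, A i j • y j) (∑ j, A k j • y j) = if i = k then Δ i else 0

section Vectors

variable {E : Type*} [AddCommGroup E] [Module ℝ E]

variable (G C M) in
open Classical in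
/-- The score vectors `A_RRᵀ Δ_RR⁻¹ ε_R`. -/
noncomputable def scoreVec (A : Matrix (Fin d) (Fin d) ℝ) (Δ : Fin d → ℝ) (y : Fin d → E)
    (s : Fin d) : E :=
  ∑ t, if t ∈ G.right C then (A t s * (Δ t)⁻¹) • ∑ j, A t j • y j else 0

variable (G C M) in
/-- The residuals in the regression of `y_q` on `y_v`, `y_C`. -/
noncomputable def fosterResid (A : Matrix (Fin d) (Fin d) ℝ) (Δ : Fin d → ℝ) (y : Fin d → E)
    (s : Fin d) : E :=
  ∑ t, blockInv (G.q C M) (G.paramConc C A Δ) s t • G.scoreVec C A Δ y t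

variable (G C M) in
open Classical in
/-- The residuals `η_u` of the summary graph model. -/
noncomputable def summaryResid (A : Matrix (Fin d) (Fin d) ℝ) (Δ : Fin d → ℝ) (y : Fin d → E)
    (i : Fin d) : E :=
  ∑ j, A i j • y j
    - (∑ s, if s ∈ G.p C M then G.paramD C M A i s • ∑ j, A s j • y j else 0)
    - ∑ s, if s ∈ G.q C M then G.paramD C M A i s • G.fosterResid C M A Δ y s else 0

end Vectors

variable (G C M) in
open Classical in
/-- The coefficients of all variables in the equations for the residuals `η_u` of the summary
graph model, including those of `Y_C`. -/
noncomputable def summaryCoef (A : Matrix (Fin d) (Fin d) ℝ) (Δ : Fin d → ℝ) :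
    Matrix (Fin d) (Fin d) ℝ :=
  fun i j => (A - A * blockInv (G.p C M) A * A) i j -
    ∑ s, if s ∈ G.q C M then G.paramD C M A i s *
      (blockInv (G.q C M) (G.paramConc C A Δ) * G.paramConc C A Δ) s j else 0

namespace IsTriangularSystem

variable {E : Type*} [AddCommGroup E] [Module ℝ E] {A : Matrix (Fin d) (Fin d) ℝ} {Δ : Fin d → ℝ}
  {Q : LinearMap.BilinForm ℝ E} {y : Fin d → E}

/-! ### Structural zeros -/

theorem edgeA_of_ne_zero (hs : G.IsTriangularSystem A Δ Q y) (i k : Fin d) (h : A i k ≠ 0) :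
    G.edgeA i k := by
  by_contra h'
  rw [edgeA, not_or] at h'
  exact h (hs.zero i k h'.1 h'.2)

theorem arrow_of_ne_zero (hs : G.IsTriangularSystem A Δ Q y) {i k : Fin d} (h : A i k ≠ 0)
    (hik : k ≠ i) : G.arrow i k :=
  (hs.edgeA_of_ne_zero i k h).resolve_left hik.symm

theorem eq_zero_of_right (hs : G.IsTriangularSystem A Δ Q y) {r t : Fin d} (hr : r ∈ G.right C)
    (ht : t ∉ G.right C) : A r t = 0 :=
  hs.zero r t (fun h => ht (h ▸ hr)) fun h => ht (mem_right_of_arrow hr h)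

theorem isRegularOn_p (hs : G.IsTriangularSystem A Δ Q y) : IsRegularOn (G.p C M) A := by
  refine isRegularOn_of_forall fun x hx0 hx i => ?_
  by_cases hi : i ∈ G.p C M
  · refine eq_zero_of_triangular (G.p C M) A x (fun r _ => hs.diag r) (fun r _ j hj hA => ?_) hx i hi
    by_cases hjp : j ∈ G.p C M
    · exact .inr ⟨hjp, G.lt_of_arrow _ _ (hs.arrow_of_ne_zero hA hj)⟩
    · exact .inl (hx0 j hjp)
  · exact hx0 i hi

/-- The quadratic form of the concentration matrix at `x` is a positively weighted sum of squares of
the entries of `A_RR x_R`. If it vanishes, so does `A_RR x_R`, and then `x`, because `A_RR` is unit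
triangular. -/
theorem isRegularOn_q (hs : G.IsTriangularSystem A Δ Q y) :
    IsRegularOn (G.q C M) (G.paramConc C A Δ) := by
  classical
  refine isRegularOn_of_forall fun x hx0 hx i => ?_
  have h0 : ∑ t, (if t ∈ G.right C then (Δ t)⁻¹ * (∑ j, A t j * x j) ^ 2 else 0) = 0 := by
    have h1 : ∑ r, x r * ∑ j, G.paramConc C A Δ r j * x j = 0 := by
      refine Finset.sum_eq_zero fun r _ => ?_
      by_cases hr : r ∈ G.q C M
      · rw [hx r hr, mul_zero]
      · rw [hx0 r hr, zero_mul]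
    refine Eq.trans ?_ h1
    simp only [paramConc, Finset.sum_mul, Finset.mul_sum]
    rw [Finset.sum_congr rfl fun r _ => Finset.sum_comm, Finset.sum_comm]
    refine Finset.sum_congr rfl fun t _ => ?_
    split_ifs
    · rw [sq, Finset.sum_mul_sum, Finset.mul_sum]
      refine Finset.sum_congr rfl fun r _ => ?_
      rw [Finset.mul_sum]
      exact Finset.sum_congr rfl fun j _ => by ring
    · simp
  have hnn : ∀ t ∈ Finset.univ,
      0 ≤ if t ∈ G.right C then (Δ t)⁻¹ * (∑ j, A t j * x j) ^ 2 else 0 := by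
    intro t _
    split_ifs
    · exact mul_nonneg (inv_nonneg.2 (hs.pos t).le) (sq_nonneg _)
    · exact le_rfl
  rw [Finset.sum_eq_zero_iff_of_nonneg hnn] at h0
  by_cases hi : i ∈ G.right C
  · refine eq_zero_of_triangular (G.right C) A x (fun r _ => hs.diag r)
      (fun r hr j hj hA => ?_) (fun r hr => ?_) i hi
    · have := hs.arrow_of_ne_zero hA hj
      exact .inr ⟨mem_right_of_arrow hr this, G.lt_of_arrow _ _ this⟩
    · have := h0 r (Finset.mem_univ r)
      rw [if_pos hr] at this
      exact pow_eq_zero_iff two_ne_zero |>.1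
        ((mul_eq_zero.1 this).resolve_left (inv_ne_zero (hs.pos r).ne'))
  · exact hx0 i fun h => hi (q_subset_right h)

theorem edgeConc_of_ne_zero (hs : G.IsTriangularSystem A Δ Q y) (r s : Fin d)
    (h : G.paramConc C A Δ r s ≠ 0) : G.edgeConc C r s := by
  classical
  rw [paramConc] at h
  obtain ⟨t, -, ht⟩ := Finset.exists_ne_zero_of_sum_ne_zero h
  split_ifs at ht with htR
  · exact ⟨t, htR, hs.edgeA_of_ne_zero _ _ (left_ne_zero_of_mul (left_ne_zero_of_mul ht)),
      hs.edgeA_of_ne_zero _ _ (right_ne_zero_of_mul ht)⟩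
  · exact absurd rfl ht

theorem edgeD_of_ne_zero (hs : G.IsTriangularSystem A Δ Q y) {i k : Fin d}
    (h : G.paramD C M A i k ≠ 0) : G.edgeD C M i k :=
  partialClosure_of_partialInv_ne_zero hs.isRegularOn_p hs.edgeA_of_ne_zero
    (fun i _ => edgeA_refl i) h

theorem edgeZ_of_ne_zero (hs : G.IsTriangularSystem A Δ Q y) {s k : Fin d}
    (h : G.paramQ C M A Δ s k ≠ 0) : G.edgeZ C M s k :=
  partialClosure_of_partialInv_ne_zero hs.isRegularOn_q hs.edgeConc_of_ne_zero
    (fun _ hi => edgeConc_refl (q_subset_right hi)) h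

theorem edgeW_of_ne_zero (hs : G.IsTriangularSystem A Δ Q y) {i k : Fin d}
    (h : G.paramW C M A Δ i k ≠ 0) : G.edgeW C M i k := by
  classical
  by_contra hW
  simp only [edgeW, not_or] at hW
  obtain ⟨h1, h2, h3⟩ := hW
  refine h ?_
  rw [paramW, if_neg h1, zero_add, Finset.sum_eq_zero, Finset.sum_eq_zero, add_zero]
  · refine fun s _ => Finset.sum_eq_zero fun t _ => ite_eq_right_iff.2 fun hst => ?_
    by_contra h0
    exact h3 ⟨s, hst.1, t, hst.2,
      hs.edgeD_of_ne_zero (left_ne_zero_of_mul (left_ne_zero_of_mul h0)),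
      hs.edgeZ_of_ne_zero (right_ne_zero_of_mul (left_ne_zero_of_mul h0)),
      hs.edgeD_of_ne_zero (right_ne_zero_of_mul h0)⟩
  · refine fun s _ => ite_eq_right_iff.2 fun hsp => ?_
    by_contra h0
    exact h2 ⟨s, hsp, hs.edgeD_of_ne_zero (left_ne_zero_of_mul (left_ne_zero_of_mul h0)),
      hs.edgeD_of_ne_zero (right_ne_zero_of_mul h0)⟩

theorem notMem_p_of_mem_u {i : Fin d} (hi : i ∈ G.u C M) : i ∉ G.p C M := fun h => hi.2 h.2

/-- The equation parameters of the summary graph model are the generating ones unless an arrow is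
induced. -/
theorem paramH_eq_of_not_inducedArrow (hs : G.IsTriangularSystem A Δ Q y) {i k : Fin d}
    (hi : i ∈ G.u C M) (hk : k ∉ M) (h : ¬ G.InducedArrow C M i k) :
    G.paramH C M A Δ i k = A i k := by
  classical
  rw [InducedArrow, not_or] at h
  have hD : G.paramD C M A i k = A i k :=
    partialInv_eq_of_not_linePath hs.isRegularOn_p hs.edgeA_of_ne_zero (notMem_p_of_mem_u hi)
      (fun h => hk h.2) h.1
  rw [paramH, hD]
  split_ifs with hkv
  · rw [Finset.sum_eq_zero, add_zero]
    refine fun s _ => ite_eq_right_iff.2 fun hsq => ?_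
    by_contra h0
    exact h.2 ⟨hkv, s, hsq, hs.edgeD_of_ne_zero (left_ne_zero_of_mul h0),
      hs.edgeZ_of_ne_zero (right_ne_zero_of_mul h0)⟩
  · rfl

theorem edgeH_of_ne_zero (hs : G.IsTriangularSystem A Δ Q y) {i k : Fin d} (hi : i ∈ G.u C M)
    (hk : k ∉ M) (h : G.paramH C M A Δ i k ≠ 0) : G.edgeH C M i k := by
  by_contra h'
  rw [edgeH, not_or] at h'
  rw [hs.paramH_eq_of_not_inducedArrow hi hk h'.2] at h
  exact h'.1 (hs.edgeA_of_ne_zero i k h)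

/-- A `p`-line path from `i ∈ u` back to `i` would be a directed cycle. -/
theorem paramD_self (hs : G.IsTriangularSystem A Δ Q y) {i : Fin d} (hi : i ∈ G.u C M) :
    G.paramD C M A i i = 1 := by
  rw [paramD, partialInv_eq_of_not_linePath hs.isRegularOn_p hs.edgeA_of_ne_zero
    (notMem_p_of_mem_u hi) (notMem_p_of_mem_u hi), hs.diag]
  rintro ⟨s, hsp, t, -, h1, h2, h3⟩
  have his : i ≠ s := fun h => notMem_p_of_mem_u hi (h ▸ hsp)
  have hsi : Relation.ReflTransGen G.arrow s i := by
    refine Relation.ReflTransGen.trans ?_ (reflTransGen_of_edgeA h3)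
    clear h3
    induction h2 with
    | refl => exact .refl
    | tail _ h ih => exact ih.trans (reflTransGen_of_edgeA h.2.2)
  exact lt_irrefl i (lt_of_ancestor (G := G) (Relation.TransGen.head' (h1.resolve_left his) hsi))

/-! ### The equations of the summary graph model -/

/-- The score vectors are the concentration matrix applied to `y`, since the residuals are `A`
applied to `y`. -/
theorem fosterResid_eq (A : Matrix (Fin d) (Fin d) ℝ) (Δ : Fin d → ℝ) (y : Fin d → E)
    (s : Fin d) : G.fosterResid C M A Δ y s =
      ∑ j, (blockInv (G.q C M) (G.paramConc C A Δ) * G.paramConc C A Δ) s j • y j := by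
  classical
  have h : ∀ t, G.scoreVec C A Δ y t = ∑ j, G.paramConc C A Δ t j • y j := by
    intro t
    simp only [scoreVec, paramConc, Finset.sum_smul]
    rw [Finset.sum_comm]
    refine Finset.sum_congr rfl fun r _ => ?_
    split_ifs
    · rw [Finset.smul_sum]
      exact Finset.sum_congr rfl fun j _ => smul_smul _ _ _
    · simp
  simp only [fosterResid, h, Matrix.mul_apply, Finset.sum_smul, Finset.smul_sum, smul_smul]
  exact Finset.sum_comm

theorem summaryResid_eq (A : Matrix (Fin d) (Fin d) ℝ) (Δ : Fin d → ℝ) (y : Fin d → E)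
    {i : Fin d} (hi : i ∈ G.u C M) :
    G.summaryResid C M A Δ y i = ∑ j, G.summaryCoef C M A Δ i j • y j := by
  classical
  have h1 : (∑ s, if s ∈ G.p C M then G.paramD C M A i s • ∑ j, A s j • y j else 0) =
      ∑ j, (A * blockInv (G.p C M) A * A) i j • y j := by
    have : ∀ s, (if s ∈ G.p C M then G.paramD C M A i s • ∑ j, A s j • y j else 0) =
        ∑ j, ((A * blockInv (G.p C M) A) i s * A s j) • y j := by
      intro s
      split_ifs with hsp
      · rw [paramD, partialInv, if_neg (notMem_p_of_mem_u hi), if_pos hsp, Finset.smul_sum]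
        exact Finset.sum_congr rfl fun j _ => smul_smul _ _ _
      · simp [Matrix.mul_apply, blockInv_of_notMem_right hsp]
    rw [Finset.sum_congr rfl fun s _ => this s, Finset.sum_comm]
    refine Finset.sum_congr rfl fun j _ => ?_
    rw [Matrix.mul_apply (M := A * blockInv (G.p C M) A), Finset.sum_smul]
  rw [summaryResid, h1, ← Finset.sum_sub_distrib]
  have h2 : (∑ s, if s ∈ G.q C M then G.paramD C M A i s • G.fosterResid C M A Δ y s else 0) =
      ∑ j, (∑ s, if s ∈ G.q C M then G.paramD C M A i s *
        (blockInv (G.q C M) (G.paramConc C A Δ) * G.paramConc C A Δ) s j else 0) • y j := by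
    simp only [Finset.sum_smul]
    rw [Finset.sum_comm]
    refine Finset.sum_congr rfl fun s _ => ?_
    split_ifs
    · rw [fosterResid_eq, Finset.smul_sum]
      exact Finset.sum_congr rfl fun j _ => smul_smul _ _ _
    · simp
  rw [h2, ← Finset.sum_sub_distrib]
  simp only [summaryCoef, Matrix.sub_apply, sub_smul]

/-- The Schur complement formula is applied to all columns: it annihilates those of `p`, because
`A_pp⁻¹ A_pp = 1`, and agrees with `inv_p A` on the rest. -/
theorem eliminated_apply (hs : G.IsTriangularSystem A Δ Q y) {i : Fin d} (hi : i ∈ G.u C M)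
    (j : Fin d) : j ∈ G.p C M ∧ (A - A * blockInv (G.p C M) A * A) i j = 0 ∨
      j ∉ G.p C M ∧ (A - A * blockInv (G.p C M) A * A) i j = G.paramD C M A i j := by
  by_cases hj : j ∈ G.p C M
  · refine .inl ⟨hj, ?_⟩
    rw [Matrix.sub_apply, Matrix.mul_assoc, Matrix.mul_apply, Finset.sum_eq_single j, Matrix.mul_apply,
      sum_blockInv_mul hs.isRegularOn_p hj hj, if_pos rfl, mul_one, sub_self]
    · intro t _ htj
      rw [Matrix.mul_apply]
      by_cases ht : t ∈ G.p C M
      · rw [sum_blockInv_mul hs.isRegularOn_p ht hj, if_neg htj, mul_zero]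
      · simp [blockInv_of_notMem_left ht]
    · simp
  · refine .inr ⟨hj, ?_⟩
    rw [paramD, partialInv, if_neg (notMem_p_of_mem_u hi), if_neg hj]

theorem paramConc_eq_zero (hs : G.IsTriangularSystem A Δ Q y) {j : Fin d} (hj : j ∉ G.right C)
    (r : Fin d) : G.paramConc C A Δ r j = 0 := by
  classical
  rw [paramConc]
  refine Finset.sum_eq_zero fun t _ => ite_eq_right_iff.2 fun ht => ?_
  rw [hs.eq_zero_of_right ht hj, mul_zero]

theorem summaryCoef_of_notMem_right (hs : G.IsTriangularSystem A Δ Q y) {i j : Fin d}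
    (hj : j ∉ G.right C) :
    G.summaryCoef C M A Δ i j = (A - A * blockInv (G.p C M) A * A) i j := by
  classical
  rw [summaryCoef, Finset.sum_eq_zero, sub_zero]
  refine fun s _ => ite_eq_right_iff.2 fun _ => ?_
  rw [Matrix.mul_apply, Finset.sum_eq_zero, mul_zero]
  intro t _
  rw [hs.paramConc_eq_zero hj, mul_zero]

theorem summaryCoef_of_mem_u (hs : G.IsTriangularSystem A Δ Q y) {i j : Fin d}
    (hi : i ∈ G.u C M) (hj : j ∈ G.u C M) :
    G.summaryCoef C M A Δ i j = G.paramD C M A i j := by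
  rw [hs.summaryCoef_of_notMem_right hj.1]
  rcases hs.eliminated_apply hi j with h | h
  · exact absurd h.1 (notMem_p_of_mem_u hj)
  · exact h.2

theorem summaryCoef_of_mem_p (hs : G.IsTriangularSystem A Δ Q y) {i j : Fin d}
    (hi : i ∈ G.u C M) (hj : j ∈ G.p C M) : G.summaryCoef C M A Δ i j = 0 := by
  rw [hs.summaryCoef_of_notMem_right hj.1]
  rcases hs.eliminated_apply hi j with h | h
  · exact h.2
  · exact absurd hj h.1

/-- On the columns of `q` the subtracted sum reduces to the entry of `D` itself. Together with
`summaryCoef_of_mem_p` this removes every variable of `M` from the equations of `η_u`. -/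
theorem summaryCoef_of_mem_q (hs : G.IsTriangularSystem A Δ Q y) {i j : Fin d}
    (hi : i ∈ G.u C M) (hj : j ∈ G.q C M) : G.summaryCoef C M A Δ i j = 0 := by
  classical
  rw [summaryCoef, Finset.sum_eq_single j, if_pos hj, Matrix.mul_apply,
    sum_blockInv_mul hs.isRegularOn_q hj hj, if_pos rfl, mul_one]
  · rcases hs.eliminated_apply hi j with h | h
    · exact absurd (q_subset_right hj) h.1.1
    · rw [h.2, sub_self]
  · refine fun s _ hsj => ite_eq_right_iff.2 fun hsq => ?_
    rw [Matrix.mul_apply, sum_blockInv_mul hs.isRegularOn_q hsq hj, if_neg hsj, mul_zero]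
  · simp

theorem summaryCoef_eq_paramH (hs : G.IsTriangularSystem A Δ Q y) {i j : Fin d}
    (hi : i ∈ G.u C M) (hj : j ∈ G.u C M ∨ j ∈ G.v C M) :
    G.summaryCoef C M A Δ i j = G.paramH C M A Δ i j := by
  classical
  rcases hj with hj | hj
  · rw [hs.summaryCoef_of_mem_u hi hj, paramH, if_neg fun h => hj.1 (v_subset_right h)]
  · rw [paramH, if_pos hj, summaryCoef]
    rcases hs.eliminated_apply hi j with h | h
    · exact absurd (v_subset_right hj) h.1.1
    · rw [h.2, sub_eq_add_neg, ← Finset.sum_neg_distrib]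
      congr 1
      refine Finset.sum_congr rfl fun s _ => ?_
      split_ifs with hsq
      -- The minus sign in the block `-F_aa⁻¹ F_ab` of partial inversion turns the subtraction into
      -- the addition in `paramH`.
      · rw [paramQ, partialInv, if_pos hsq, if_neg fun h => hj.2 h.2, mul_neg]
      · simp

theorem ancestor_of_summaryCoef_ne_zero (hs : G.IsTriangularSystem A Δ Q y) {i j : Fin d}
    (hi : i ∈ G.u C M) (hj : j ∈ G.u C M) (hij : j ≠ i) (h : G.summaryCoef C M A Δ i j ≠ 0) :
    G.toMixed.Ancestor i j := by
  rw [hs.summaryCoef_of_mem_u hi hj] at h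
  exact (eq_or_ancestor_of_edgeD (hs.edgeD_of_ne_zero h)).resolve_left hij.symm

/-! ### The residual covariances of the summary graph model -/

/-- The residual is uncorrelated with all residuals in `R`, and the triangular system on `R`
expresses `y_R` through these. -/
theorem resid_right_eq_zero (hs : G.IsTriangularSystem A Δ Q y) {j r : Fin d}
    (hj : j ∉ G.right C) (hr : r ∈ G.right C) : Q (∑ l, A j l • y l) (y r) = 0 := by
  refine eq_zero_of_triangular (G.right C) A (fun r => Q (∑ l, A j l • y l) (y r))
    (fun r _ => hs.diag r) (fun r hr l hl hA => ?_) (fun r hr => ?_) r hr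
  · have := hs.arrow_of_ne_zero hA hl
    exact .inr ⟨mem_right_of_arrow hr this, G.lt_of_arrow _ _ this⟩
  · have := hs.resid j r
    rw [if_neg fun h : j = r => hj (h ▸ hr), map_sum (Q _)] at this
    simpa only [map_smul, smul_eq_mul] using this

theorem scoreVec_resid (hs : G.IsTriangularSystem A Δ Q y) (s r : Fin d) :
    (r ∈ G.right C → Q (G.scoreVec C A Δ y s) (∑ l, A r l • y l) = A r s) ∧
      (r ∉ G.right C → Q (G.scoreVec C A Δ y s) (∑ l, A r l • y l) = 0) := by
  classical
  have h : Q (G.scoreVec C A Δ y s) (∑ l, A r l • y l) =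
      ∑ t, if t ∈ G.right C then A t s * (Δ t)⁻¹ * (if t = r then Δ t else 0) else 0 := by
    rw [scoreVec, map_sum Q, LinearMap.sum_apply]
    refine Finset.sum_congr rfl fun t _ => ?_
    by_cases ht : t ∈ G.right C
    · rw [if_pos ht, if_pos ht, map_smul, LinearMap.smul_apply, hs.resid, smul_eq_mul]
    · rw [if_neg ht, if_neg ht, map_zero, LinearMap.zero_apply]
  refine ⟨fun hr => ?_, fun hr => ?_⟩
  · rw [h, Finset.sum_eq_single r, if_pos hr, if_pos rfl, inv_mul_cancel_right₀ (hs.pos r).ne']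
    · intro t _ htr
      simp [htr]
    · simp
  · rw [h]
    refine Finset.sum_eq_zero fun t _ => ite_eq_right_iff.2 fun ht => ?_
    rw [if_neg fun h : t = r => hr (h ▸ ht), mul_zero]

/-- The scores are dual to `y_R`: their products with `A_RR y_R` are the entries of `A_RR`, and back
substitution, applied to the difference of the two sides, removes `A_RR`. -/
theorem scoreVec_apply (hs : G.IsTriangularSystem A Δ Q y) {s j : Fin d}
    (hj : j ∈ G.right C) :
    Q (G.scoreVec C A Δ y s) (y j) = if s = j then 1 else 0 := by
  rw [← sub_eq_zero]
  refine eq_zero_of_triangular (G.right C) A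
    (fun j => Q (G.scoreVec C A Δ y s) (y j) - if s = j then 1 else 0)
    (fun r _ => hs.diag r) (fun r hr l hl hA => ?_) (fun r hr => ?_) j hj
  · have := hs.arrow_of_ne_zero hA hl
    exact .inr ⟨mem_right_of_arrow hr this, G.lt_of_arrow _ _ this⟩
  · have := (hs.scoreVec_resid s r).1 hr
    rw [map_sum (Q _)] at this
    simp only [map_smul, smul_eq_mul] at this
    simp only [mul_sub, Finset.sum_sub_distrib, this]
    simp

/-- In particular this is zero for `j` in `v` or `C`, since `blockInv` vanishes outside `q`; this
justifies calling these vectors residuals. -/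
theorem fosterResid_apply (hs : G.IsTriangularSystem A Δ Q y) {s j : Fin d}
    (hj : j ∈ G.right C) :
    Q (G.fosterResid C M A Δ y s) (y j) = blockInv (G.q C M) (G.paramConc C A Δ) s j := by
  rw [fosterResid, map_sum Q, LinearMap.sum_apply, Finset.sum_eq_single j]
  · rw [map_smul, LinearMap.smul_apply, hs.scoreVec_apply hj, if_pos rfl, smul_eq_mul, mul_one]
  · intro t _ htj
    rw [map_smul, LinearMap.smul_apply]
    rw [hs.scoreVec_apply hj, if_neg htj, smul_zero]
  · simp

theorem fosterResid_resid (hs : G.IsTriangularSystem A Δ Q y) (s : Fin d) {j : Fin d}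
    (hj : j ∉ G.right C) :
    Q (G.fosterResid C M A Δ y s) (∑ l, A j l • y l) = 0 := by
  rw [fosterResid, map_sum Q, LinearMap.sum_apply]
  refine Finset.sum_eq_zero fun t _ => ?_
  rw [map_smul, LinearMap.smul_apply, (hs.scoreVec_resid t j).2 hj, smul_zero]

theorem fosterResid_fosterResid (hs : G.IsTriangularSystem A Δ Q y) {s t : Fin d}
    (hsq : s ∈ G.q C M) (ht : t ∈ G.q C M) :
    Q (G.fosterResid C M A Δ y s) (G.fosterResid C M A Δ y t) = G.paramQ C M A Δ s t := by
  rw [hs.symm, fosterResid_eq A Δ y s, map_sum (Q _), paramQ, partialInv, if_pos hsq, if_pos ht]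
  have h : ∀ j, (Q (G.fosterResid C M A Δ y t))
      ((blockInv (G.q C M) (G.paramConc C A Δ) * G.paramConc C A Δ) s j • y j) =
      (blockInv (G.q C M) (G.paramConc C A Δ) * G.paramConc C A Δ) s j *
        blockInv (G.q C M) (G.paramConc C A Δ) t j := by
    intro j
    rw [map_smul, smul_eq_mul]
    by_cases hj : j ∈ G.right C
    · rw [hs.fosterResid_apply hj]
    · rw [Matrix.mul_apply, Finset.sum_eq_zero, zero_mul, zero_mul]
      intro r _
      rw [hs.paramConc_eq_zero hj, mul_zero]
  rw [Finset.sum_congr rfl fun j _ => h j, Finset.sum_eq_single s, Matrix.mul_apply,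
    sum_blockInv_mul hs.isRegularOn_q hsq hsq, if_pos rfl, one_mul, ← blockInv_transpose]
  -- The concentration matrix is symmetric, so the transpose can be dropped.
  · congr 1
    ext r j
    simp only [Matrix.transpose_apply, paramConc]
    refine Finset.sum_congr rfl fun t _ => ?_
    split_ifs
    · ring
    · rfl
  · intro j _ hj
    by_cases hjq : j ∈ G.q C M
    · rw [Matrix.mul_apply, sum_blockInv_mul hs.isRegularOn_q hsq hjq, if_neg hj.symm, zero_mul]
    · rw [blockInv_of_notMem_right hjq, mul_zero]
  · simp

theorem summaryResid_apply_left (i : Fin d) (z : E) : Q (G.summaryResid C M A Δ y i) z =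
    Q (∑ j, A i j • y j) z
      - ∑ s, (open Classical in if s ∈ G.p C M then
          G.paramD C M A i s * Q (∑ j, A s j • y j) z else 0)
      - ∑ s, open Classical in if s ∈ G.q C M then
          G.paramD C M A i s * Q (G.fosterResid C M A Δ y s) z else 0 := by
  classical
  rw [summaryResid, map_sub, map_sub, LinearMap.sub_apply, LinearMap.sub_apply]
  congr 1
  · congr 1
    rw [map_sum, LinearMap.sum_apply]
    exact Finset.sum_congr rfl fun s _ => by split_ifs <;> simp
  · rw [map_sum, LinearMap.sum_apply]
    exact Finset.sum_congr rfl fun s _ => by split_ifs <;> simp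

/-- Residuals of `u` and `p` are uncorrelated with all of `y_R`, and foster residuals with `y_r` for
`r ∈ R` outside `M`. -/
theorem summaryResid_apply_right (hs : G.IsTriangularSystem A Δ Q y) (i : Fin d) {r : Fin d}
    (hi : i ∈ G.u C M) (hr : r ∈ G.right C) (hrM : r ∉ M) :
    Q (G.summaryResid C M A Δ y i) (y r) = 0 := by
  classical
  rw [summaryResid_apply_left, hs.resid_right_eq_zero hi.1 hr, Finset.sum_eq_zero,
    Finset.sum_eq_zero, sub_zero, sub_zero]
  · refine fun s _ => ite_eq_right_iff.2 fun _ => ?_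
    rw [hs.fosterResid_apply hr, blockInv_of_notMem_right fun h => hrM h.2, mul_zero]
  · refine fun s _ => ite_eq_right_iff.2 fun hsp => ?_
    rw [hs.resid_right_eq_zero hsp.1 hr, mul_zero]

theorem summaryResid_resid (hs : G.IsTriangularSystem A Δ Q y) (i : Fin d) {j : Fin d}
    (hj : j ∉ G.right C) : Q (G.summaryResid C M A Δ y i) (∑ l, A j l • y l) =
      (if i = j then Δ i else 0)
        - open Classical in if j ∈ G.p C M then G.paramD C M A i j * Δ j else 0 := by
  classical
  rw [summaryResid_apply_left, hs.resid, Finset.sum_eq_single j, hs.resid, if_pos rfl,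
    Finset.sum_eq_zero (s := Finset.univ), sub_zero]
  · refine fun s _ => ite_eq_right_iff.2 fun _ => ?_
    rw [hs.fosterResid_resid s hj, mul_zero]
  · refine fun s _ hsj => ite_eq_right_iff.2 fun _ => ?_
    rw [hs.resid, if_neg hsj, mul_zero]
  · simp

theorem summaryResid_fosterResid (hs : G.IsTriangularSystem A Δ Q y) {i t : Fin d}
    (hi : i ∈ G.u C M) (ht : t ∈ G.q C M) :
    Q (G.summaryResid C M A Δ y i) (G.fosterResid C M A Δ y t) =
      - ∑ s, open Classical in if s ∈ G.q C M then
          G.paramD C M A i s * G.paramQ C M A Δ s t else 0 := by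
  classical
  rw [summaryResid_apply_left, hs.symm, hs.fosterResid_resid t hi.1, Finset.sum_eq_zero,
    sub_zero, zero_sub]
  · congr 1
    refine Finset.sum_congr rfl fun s _ => ?_
    split_ifs with hsq
    · rw [hs.fosterResid_fosterResid hsq ht]
    · rfl
  · refine fun s _ => ite_eq_right_iff.2 fun hsp => ?_
    rw [hs.symm, hs.fosterResid_resid t hsp.1, mul_zero]

/-- The covariance matrix of the residuals `η_u` is `W_uu`. -/
theorem summaryResid_summaryResid (hs : G.IsTriangularSystem A Δ Q y) {i k : Fin d}
    (hi : i ∈ G.u C M) (hk : k ∈ G.u C M) :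
    Q (G.summaryResid C M A Δ y i) (G.summaryResid C M A Δ y k) = G.paramW C M A Δ i k := by
  classical
  rw [hs.symm, summaryResid_apply_left, hs.symm, hs.summaryResid_resid i hk.1,
    if_neg (notMem_p_of_mem_u hk), sub_zero, paramW, sub_sub, sub_eq_add_neg, neg_add, add_assoc]
  congr 1
  congr 1
  · rw [← Finset.sum_neg_distrib]
    refine Finset.sum_congr rfl fun s _ => ?_
    split_ifs with hsp
    · rw [hs.symm, hs.summaryResid_resid i hsp.1, if_pos hsp,
        if_neg fun h : i = s => notMem_p_of_mem_u hi (h ▸ hsp)]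
      ring
    · simp
  · rw [← Finset.sum_neg_distrib, Finset.sum_comm]
    refine Finset.sum_congr rfl fun t _ => ?_
    by_cases htq : t ∈ G.q C M
    · rw [if_pos htq, hs.symm, hs.summaryResid_fosterResid hi htq, mul_neg, neg_neg, Finset.mul_sum]
      refine Finset.sum_congr rfl fun s _ => ?_
      by_cases hsq : s ∈ G.q C M
      · rw [if_pos hsq, if_pos ⟨hsq, htq⟩]; ring
      · rw [if_neg hsq, if_neg fun h => hsq h.1, mul_zero]
    · rw [if_neg htq, neg_zero, Finset.sum_eq_zero]
      exact fun s _ => if_neg fun h => htq h.2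

/-- A kernel vector `x` gives a combination of the `η_j` with zero variance, which is zero by
definiteness. Among the `η_j` with `j ∈ u`, only `η_m` is correlated with the generating residual of
`m`, so pairing with the latter gives `x m * Δ m = 0`. -/
theorem isRegularOn_paramW (hs : G.IsTriangularSystem A Δ Q y) {c : Set (Fin d)}
    (hc : c ⊆ G.u C M) : IsRegularOn c (G.paramW C M A Δ) := by
  classical
  refine isRegularOn_of_forall fun x hx0 hx m => ?_
  by_cases hm : m ∈ c
  swap
  · exact hx0 m hm
  have hQ : ∀ w, Q (∑ j, x j • G.summaryResid C M A Δ y j) w =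
      ∑ j, x j * Q (G.summaryResid C M A Δ y j) w := fun w => by
    simp [map_sum, LinearMap.sum_apply]
  have hz : ∑ j, x j • G.summaryResid C M A Δ y j = 0 := by
    refine hs.definite _ ?_
    rw [hQ]
    refine Finset.sum_eq_zero fun i _ => ?_
    by_cases hi : i ∈ c
    · rw [hs.symm, hQ, ← mul_zero (x i), ← hx i hi]
      congr 1
      refine Finset.sum_congr rfl fun j _ => ?_
      by_cases hj : j ∈ c
      · rw [hs.symm, hs.summaryResid_summaryResid (hc hi) (hc hj), mul_comm]
      · rw [hx0 j hj, zero_mul, mul_zero]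
    · rw [hx0 i hi, zero_mul]
  have h1 := hQ (∑ l, A m l • y l)
  rw [hz, map_zero, LinearMap.zero_apply, Finset.sum_eq_single m,
    hs.summaryResid_resid m (hc hm).1, if_pos rfl, if_neg (notMem_p_of_mem_u (hc hm)),
    sub_zero] at h1
  · exact (mul_eq_zero.1 h1.symm).resolve_right (hs.pos m).ne'
  · intro j _ hjm
    rw [hs.summaryResid_resid j (hc hm).1, if_neg hjm, if_neg (notMem_p_of_mem_u (hc hm)), sub_zero,
      mul_zero]
  · simp

/-! ### The dependences in the maximal ancestral graph model -/

/-- The dependence of `y_i` on `y_k` given `y_{c_i}`, `y_v`, `y_C`, in terms of the parameters of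
the summary graph model. -/
theorem partialInv_gram_eq (hs : G.IsTriangularSystem A Δ Q y) (hCM : Disjoint C M)
    {i k : Fin d} (hi : i ∈ G.u C M) (hk : k ∈ G.anc C M i ∪ G.v C M ∪ C)
    {S : Matrix (Fin d) (Fin d) ℝ} (hS : ∀ r s, S r s = Q (y r) (y s))
    (hreg : IsRegularOn (G.anc C M i ∪ G.v C M ∪ C) S) :
    partialInv (G.anc C M i ∪ G.v C M ∪ C) S i k = -G.summaryCoef C M A Δ i k +
      ∑ m, (G.paramW C M A Δ * blockInv (G.anc C M i) (G.paramW C M A Δ)) i m *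
        G.summaryCoef C M A Δ m k := by
  classical
  set c := G.anc C M i with hc
  have hcu : c ⊆ G.u C M := fun _ h => h.1
  set W := G.paramW C M A Δ with hW
  have hWreg : IsRegularOn c W := hs.isRegularOn_paramW hcu
  -- `κ = W_ic W_cc⁻¹`, the coefficients in the regression of `η_i` on `η_c`.
  set κ : Fin d → ℝ := fun m => (W * blockInv c W) i m with hκ
  have hκ0 : ∀ m ∉ c, κ m = 0 := fun m hm => by
    simp [hκ, Matrix.mul_apply, blockInv_of_notMem_right hm]
  have hκW : ∀ r ∈ c, ∑ m, κ m * W m r = W i r := by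
    intro r hr
    change ∑ m, (W * blockInv c W) i m * W m r = W i r
    rw [← Matrix.mul_apply, Matrix.mul_assoc, Matrix.mul_apply, Finset.sum_eq_single r,
      Matrix.mul_apply, sum_blockInv_mul hWreg hr hr, if_pos rfl, mul_one]
    · intro l _ hlr
      by_cases hl : l ∈ c
      · rw [Matrix.mul_apply, sum_blockInv_mul hWreg hl hr, if_neg hlr, mul_zero]
      · simp [Matrix.mul_apply, blockInv_of_notMem_left hl]
    · simp
  set η := G.summaryResid C M A Δ y with hη
  set h := G.summaryCoef C M A Δ with hh
  have hhd : ∀ r ∈ G.u C M, h r r = 1 := fun r hr => by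
    rw [hh, hs.summaryCoef_of_mem_u hr hr, hs.paramD_self hr]
  have hib : i ∉ c ∪ G.v C M ∪ C := by
    rintro ((h1 | h1) | h1)
    · exact ne_of_mem_anc h1 rfl
    · exact hi.1 (v_subset_right h1)
    · exact hi.1 (.inl h1)
  -- nodes outside of the regressors contribute nothing to the equations of `i` and of `c`
  have hout : ∀ j ∉ c ∪ G.v C M ∪ C, ∀ m, m = i ∨ m ∈ c → j ≠ m → h m j = 0 := by
    intro j hj m hm hjm
    simp only [Set.mem_union, not_or] at hj
    have hmu : m ∈ G.u C M := hm.elim (fun h => h ▸ hi) fun h => hcu h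
    by_cases hjR : j ∈ G.right C
    · by_cases hjM : j ∈ M
      · exact hs.summaryCoef_of_mem_q hmu ⟨hjR.resolve_left hj.2, hjM⟩
      · exact absurd ⟨hjR.resolve_left hj.2, hjM⟩ hj.1.2
    · by_cases hjM : j ∈ M
      · exact hs.summaryCoef_of_mem_p hmu ⟨hjR, hjM⟩
      · by_contra h0
        have h1 := hs.ancestor_of_summaryCoef_ne_zero hmu ⟨hjR, hjM⟩ hjm h0
        rcases hm with rfl | hm
        · exact hj.1.1 ⟨⟨hjR, hjM⟩, h1⟩
        · exact hj.1.1 ⟨⟨hjR, hjM⟩, hm.2.trans h1⟩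
  -- `z` will turn out to be the residual of `y_i` in its regression on `y_c`, `y_v`, `y_C`.
  set z := η i - ∑ m, κ m • η m with hz
  have hzQ : ∀ w, Q z w = Q (η i) w - ∑ m, κ m * Q (η m) w := fun w => by
    simp [hz, map_sum, LinearMap.sum_apply]
  have hz1 : ∀ r ∈ G.v C M ∪ C, Q z (y r) = 0 := by
    intro r hr
    have hrR : r ∈ G.right C := hr.elim (fun h => v_subset_right h) .inl
    have hrM : r ∉ M := hr.elim (fun h => h.2) fun h h' => Set.disjoint_left.1 hCM h h'
    rw [hzQ, hη, hs.summaryResid_apply_right i hi hrR hrM, Finset.sum_eq_zero, sub_zero]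
    intro m _
    by_cases hm : m ∈ c
    · rw [hs.summaryResid_apply_right m (hcu hm) hrR hrM, mul_zero]
    · rw [hκ0 m hm, zero_mul]
  have hz2 : ∀ r ∈ c, Q z (η r) = 0 := by
    intro r hr
    rw [hzQ, hη, hs.summaryResid_summaryResid hi (hcu hr), ← hW, ← hκW r hr, sub_eq_zero]
    refine Finset.sum_congr rfl fun m _ => ?_
    by_cases hm : m ∈ c
    · rw [hs.summaryResid_summaryResid (hcu hm) (hcu hr)]
    · rw [hκ0 m hm, zero_mul, zero_mul]
  -- The equations of `η_c` are unit triangular in `y_c`, as `c` contains all its ancestors in `u`;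
  -- their remaining terms, in `y_v` and `y_C`, are orthogonal to `z`.
  have hz3 : ∀ r ∈ c, Q z (y r) = 0 := by
    refine eq_zero_of_triangular c h (fun r => Q z (y r)) (fun r hr => hhd r (hcu hr))
      (fun r hr j hj h0 => ?_) (fun r hr => ?_)
    · by_cases hjb : j ∈ c ∪ G.v C M ∪ C
      · rcases hjb with (hjc | hjv) | hjC
        · exact .inr ⟨hjc, lt_of_ancestor
            (hs.ancestor_of_summaryCoef_ne_zero (hcu hr) (hcu hjc) hj h0)⟩
        · exact .inl (hz1 j (.inl hjv))
        · exact .inl (hz1 j (.inr hjC))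
      · exact absurd (hout j hjb r (.inr hr) hj) h0
    · have := hz2 r hr
      rw [hη, summaryResid_eq A Δ y (hcu hr), map_sum] at this
      simpa only [map_smul, smul_eq_mul] using this
  have hz4 : ∀ r ∈ c ∪ G.v C M ∪ C, Q z (y r) = 0 := by
    rintro r ((hr | hr) | hr)
    · exact hz3 r hr
    · exact hz1 r (.inl hr)
    · exact hz1 r (.inr hr)
  have hzy : z = ∑ j, (h i j - ∑ m, κ m * h m j) • y j := by
    simp only [sub_smul, Finset.sum_sub_distrib, Finset.sum_smul]
    rw [hz, hη, summaryResid_eq A Δ y hi, Finset.sum_comm]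
    congr 1
    refine Finset.sum_congr rfl fun m _ => ?_
    by_cases hm : m ∈ c
    · rw [summaryResid_eq A Δ y (hcu hm), Finset.smul_sum]
      exact Finset.sum_congr rfl fun j _ => smul_smul _ _ _
    · simp [hκ0 m hm]
  have hsum0 : ∀ j ∉ c ∪ G.v C M ∪ C, ∑ m, κ m * h m j = 0 := by
    refine fun j hj => Finset.sum_eq_zero fun m _ => ?_
    by_cases hm : m ∈ c
    · rw [hout j hj m (.inr hm) fun h => hj (.inl (.inl (h ▸ hm))), mul_zero]
    · rw [hκ0 m hm, zero_mul]
  -- The coefficients are read off from `z = y_i - ∑ γ_j y_j`. The indicator cancels the coefficient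
  -- one of `y_i`, so that `γ` is supported on the regressors.
  rw [partialInv_eq_of_normal_equations hreg hib hk
    (fun j => (if j = i then 1 else 0) - (h i j - ∑ m, κ m * h m j))]
  · rw [if_neg fun h : k = i => hib (h ▸ hk)]
    ring
  · intro j hj
    rw [hsum0 j hj]
    by_cases hji : j = i
    · subst hji
      rw [if_pos rfl, hhd _ hi]; ring
    · rw [if_neg hji, hout j hj i (.inl rfl) hji]; ring
  · intro r hr
    have h1 := hz4 r hr
    rw [hzy, map_sum, LinearMap.sum_apply] at h1
    simp only [map_smul, LinearMap.smul_apply, smul_eq_mul] at h1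
    simp only [sub_mul (_ : ℝ) (h i _ - _), Finset.sum_sub_distrib, hS, h1]
    simp

/-- A non-zero term of the correction `W_ic W_cc⁻¹ H_ck` has three non-zero factors; their positions
form an edge of `W`, a chain in the closure of `W_cc` and an edge of `H`, which together are
`InducedByAncestors`. -/
theorem partialInv_gram_eq_neg_paramH (hs : G.IsTriangularSystem A Δ Q y) (hCM : Disjoint C M)
    {i k : Fin d} (hi : i ∈ G.u C M) (hk : k ∈ G.anc C M i ∪ G.v C M)
    {S : Matrix (Fin d) (Fin d) ℝ} (hS : ∀ r s, S r s = Q (y r) (y s))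
    (hreg : IsRegularOn (G.anc C M i ∪ G.v C M ∪ C) S) (hind : ¬ G.InducedByAncestors C M i k) :
    partialInv (G.anc C M i ∪ G.v C M ∪ C) S i k = -G.paramH C M A Δ i k := by
  have hk' : k ∈ G.u C M ∨ k ∈ G.v C M := hk.imp (fun h => h.1) id
  have hkM : k ∉ M := hk'.elim (fun h => h.2) fun h => h.2
  rw [hs.partialInv_gram_eq hCM hi (.inl hk) hS hreg, hs.summaryCoef_eq_paramH hi hk',
    Finset.sum_eq_zero, add_zero]
  intro m _
  by_contra h0
  have h1 := left_ne_zero_of_mul h0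
  have h2 := right_ne_zero_of_mul h0
  rw [Matrix.mul_apply] at h1
  obtain ⟨l, -, hl⟩ := Finset.exists_ne_zero_of_sum_ne_zero h1
  obtain ⟨h3, h4, h5⟩ := reflTransGen_of_blockInv_ne_zero
    (hs.isRegularOn_paramW fun _ h => h.1) (fun _ _ _ _ h => hs.edgeW_of_ne_zero h)
    (right_ne_zero_of_mul hl)
  rw [hs.summaryCoef_eq_paramH h4.1 hk'] at h2
  exact hind ⟨l, h3, m, h4, hs.edgeW_of_ne_zero (left_ne_zero_of_mul hl), h5,
    hs.edgeH_of_ne_zero h4.1 hkM h2⟩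

end IsTriangularSystem

/-! ## Linear triangular systems of random variables -/

namespace IsLinearTriangularSystem

variable {Ω : Type*} [MeasurableSpace Ω] {μ : Measure Ω} {A : Matrix (Fin d) (Fin d) ℝ}
  {Δ : Fin d → ℝ} {Y : Fin d → Ω → ℝ}

theorem mul_cov_mul_transpose [IsFiniteMeasure μ] (hY : G.IsLinearTriangularSystem μ A Δ Y) :
    A * Matrix.of (fun r s => cov[Y r, Y s; μ]) * A.transpose = Matrix.diagonal Δ := by
  ext i k
  have h := hY.resid i k
  rw [covariance_fun_sum_fun_sum (fun j => (hY.memLp j).const_mul _)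
    fun j => (hY.memLp j).const_mul _] at h
  rw [Matrix.diagonal_apply, ← h, Matrix.mul_apply, Finset.sum_comm]
  refine Finset.sum_congr rfl fun l _ => ?_
  rw [Matrix.mul_apply, Finset.sum_mul]
  refine Finset.sum_congr rfl fun j _ => ?_
  rw [covariance_const_mul_left, covariance_const_mul_right, Matrix.of_apply,
    Matrix.transpose_apply]
  ring

theorem isUnit_coefficients (hY : G.IsLinearTriangularSystem μ A Δ Y) : IsUnit A := by
  rw [Matrix.isUnit_iff_isUnit_det, Matrix.det_of_isUpperTriangular (fun i k hki => ?_)]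
  · simp [hY.diag]
  · exact hY.zero i k hki.ne' fun h => lt_asymm (G.lt_of_arrow _ _ h) hki

theorem posDef_cov [IsFiniteMeasure μ] (hY : G.IsLinearTriangularSystem μ A Δ Y) :
    (Matrix.of fun r s => cov[Y r, Y s; μ]).PosDef := by
  have h : (Matrix.diagonal Δ).PosDef := Matrix.PosDef.diagonal hY.pos
  rw [← hY.mul_cov_mul_transpose] at h
  exact (Matrix.IsUnit.posDef_star_right_conjugate_iff hY.isUnit_coefficients).1 h

theorem isRegularOn_cov [IsFiniteMeasure μ] (hY : G.IsLinearTriangularSystem μ A Δ Y)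
    (b : Set (Fin d)) : IsRegularOn b (Matrix.of fun r s => cov[Y r, Y s; μ]) := by
  classical
  exact (hY.posDef_cov.submatrix Subtype.val_injective).det_pos.ne'.isUnit

/-- The coordinate vectors with the bilinear form of the covariance matrix. -/
theorem isTriangularSystem [IsFiniteMeasure μ] (hY : G.IsLinearTriangularSystem μ A Δ Y) :
    G.IsTriangularSystem A Δ (Matrix.toBilin' (Matrix.of fun r s => cov[Y r, Y s; μ]))
      (fun i => Pi.single i 1) where
  diag := hY.diag
  zero := hY.zero
  pos := hY.pos
  symm a b := by
    rw [Matrix.toBilin'_apply, Matrix.toBilin'_apply, Finset.sum_comm]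
    refine Finset.sum_congr rfl fun i _ => Finset.sum_congr rfl fun j _ => ?_
    rw [Matrix.of_apply, Matrix.of_apply, covariance_comm]
    ring
  definite a ha := by
    by_contra h0
    rw [Matrix.toBilin'_apply'] at ha
    exact (hY.posDef_cov.dotProduct_mulVec_pos h0).ne' ha
  resid i k := by
    have h := congrFun (congrFun hY.mul_cov_mul_transpose i) k
    rw [Matrix.diagonal_apply] at h
    rw [← h]
    simp only [map_sum, LinearMap.sum_apply, map_smul, LinearMap.smul_apply,
      Matrix.toBilin'_single, smul_eq_mul, Matrix.mul_apply, Matrix.transpose_apply]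
    refine Finset.sum_congr rfl fun l _ => ?_
    rw [Finset.sum_mul, Finset.mul_sum]
    exact Finset.sum_congr rfl fun j _ => by ring

end IsLinearTriangularSystem

end ParentGraph

/-! ### Lack of confounding in the three models -/

theorem corollary3 {d : ℕ} (G : ParentGraph d) (C M : Set (Fin d)) (hCM : Disjoint C M)
    {Ω : Type*} [MeasurableSpace Ω] (μ : Measure Ω) [IsProbabilityMeasure μ]
    (A : Matrix (Fin d) (Fin d) ℝ) (Δ : Fin d → ℝ) (Y : Fin d → Ω → ℝ)
    (hY : G.IsLinearTriangularSystem μ A Δ Y)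
    (i k : Fin d) (hik : G.arrow i k) (hi : i ∈ G.u C M) (hk : k ∉ C ∪ M) :
    (¬ G.toMixed.HasActivePathBesidesArrow C M i k →
        G.FreeOfDirectConfounding C M A Δ i k) ∧
    (¬ (G.summary C M).HasActivePathBesidesArrow (G.anc C M i) (G.marg C M i) i k →
        G.FreeOfIndirectConfounding C M μ A Δ Y i k) ∧
    (¬ G.toMixed.HasActivePathBesidesArrow C M i k →
      ¬ (G.summary C M).HasActivePathBesidesArrow (G.anc C M i) (G.marg C M i) i k →
        G.magDependence C M μ Y i k = -A i k) := by
  have hki : k ≠ i := (G.lt_of_arrow i k hik).ne'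
  have hkM : k ∉ M := fun h => hk (.inr h)
  have hkuv := ParentGraph.mem_u_or_mem_v (G := G) hk
  -- The arrow `i ← k` itself puts `k` into `c_i` when `k ∈ u`, so `k` is always a regressor.
  have hkb : k ∈ G.anc C M i ∪ G.v C M :=
    hkuv.imp (fun h => ⟨h, Relation.TransGen.single hik⟩) id
  have hs := hY.isTriangularSystem
  have h1 : ¬ G.toMixed.HasActivePathBesidesArrow C M i k →
      G.FreeOfDirectConfounding C M A Δ i k := by
    intro h
    have hA : ¬ G.InducedArrow C M i k := fun h' =>
      h (ParentGraph.hasActivePath_of_inducedArrow hi hki hkM h')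
    have hW : ¬ G.edgeW C M i k := fun h' =>
      h (ParentGraph.hasActivePath_of_edgeW hi hki hkM h')
    exact ⟨⟨fun h' => hW h'.2.2.2, hA⟩, hs.paramH_eq_of_not_inducedArrow hi hkM hA,
      fun _ => by_contra fun h' => hW (hs.edgeW_of_ne_zero h')⟩
  have h2 : ¬ (G.summary C M).HasActivePathBesidesArrow (G.anc C M i) (G.marg C M i) i k →
      G.FreeOfIndirectConfounding C M μ A Δ Y i k := by
    intro h
    have hind : ¬ G.InducedByAncestors C M i k := fun h' =>
      h (ParentGraph.hasActivePath_of_inducedByAncestors hi hki hkuv h')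
    exact ⟨hind, hs.partialInv_gram_eq_neg_paramH hCM hi hkb
      (fun r s => (Matrix.toBilin'_single _ r s).symm) (hY.isRegularOn_cov _) hind⟩
  exact ⟨h1, h2, fun h h' => by rw [(h2 h').2, (h1 h).2.1]⟩
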